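/- Let $E$ be a finite set, let $E^*=\{e^*: e\in E\}$ be a disjoint copy of $E$, and put $(e^*)^*=e$. A transversal is an $|E|$-element subset of $E\cup E^*$ containing no pair $\{e,e^*\}$, and a subtransversal is a subset of a transversal. An orthogonal matroid $M$ on $E\cup E^*$ is given by a nonempty set $\mathcal B(M)$ of transversals (the bases) such that for all $B,B'\in\mathcal B(M)$ and $e\in B\setminus B'$ there is $f\in B\setminus B'$, $f\neq e$, with $B\triangle\{e,e^*,f,f^*\}\in\mathcal B(M)$. A circuit is a minimal subtransversal not contained in any basis. For a basis $B$ and $e\notin B$, $\mathrm{FC}(B,e)$ is the unique circuit contained in $B\triangle\{e,e^*\}$. A regular orthogonal representation of $M$ is a set $\mathcal C=-\mathcal C$ of $(0,\pm1)$-vectors in $\mathbb Z^{E\cup E^*}$ (the signed circuits) whose supports are exactly the circuits of $M$, such that $\sum_{x\in E\cup E^*}\mathbf C(x)\mathbf D(x^*)=0$ for all $\mathbf C,\mathbf D\in\mathcal C$; $M$ is regular if it has one. Let $\mathcal C$ be a regular orthogonal representation of $M$. Define $\pi(\mathbf v)(e)=\mathbf v(e)+\mathbf v(e^*)$ for $e\in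 E$, let $\langle\pi(\mathcal C)\rangle\subseteq\mathbb Z^E$ be the subgroup generated by all $\pi(\mathbf C)$, $\mathbf C\in\mathcal C$, and let $\mathrm{Jac}(\mathcal C)=\mathbb Z^E/\langle\pi(\mathcal C)\rangle$. Let $\mathcal O=\{\pm\frac12\}^E$ be the set of orientations. A circuit reversal turns $\mathbf O\in\mathcal O$ into an orientation of the form $\mathbf O+\pi(\mathbf C)$ with $\mathbf C\in\mathcal C$, and $\mathcal R(\mathcal C)$ is the set of classes of orientations under the equivalence relation of being connected by a sequence of circuit reversals. Classes in $\mathrm{Jac}(\mathcal C)$ and in $\mathcal R(\mathcal C)$ are written $[\cdot]$. A circuit signature is a set $\sigma\subseteq\mathcal C$ containing exactly one of $\mathbf C,-\mathbf C$ for each $\mathbf C\in\mathcal C$; it is acyclic if $\sum\lambda_i\mathbf C_i=0$ with distinct $\mathbf C_i\in\sigma$ and real $\lambda_i\ge 0$ implies that all $\lambda_i=0$. It defines $\beta_\sigma:\mathcal B(M)\to\mathcal O$ by $\beta_\sigma(B)(e)=\frac12\mathbf C(e')$, where $e'$ is the element of $\{e,e^*\}\setminus B$ and $\mathbf C$ is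 the member of $\sigma$ with support $\mathrm{FC}(B,e')$. For $\beta:\mathcal B(M)\to\mathcal O$ let $\bar\beta(B)=[\beta(B)]\in\mathcal R(\mathcal C)$. For a basis $B$ and an orientation $\mathbf O$ let $\mathbf F(B,\mathbf O)$ be the map from $E\cup E^*$ to the subsets of $\{1,-1\}$ that sends each $x\in B$ to $\{1,-1\}$ and each $x\notin B$ to $\{\mathrm{sign}\,\mathbf O(e)\}$, where $e\in E$ and $x\in\{e,e^*\}$. The map $\beta$ is triangulating if there are no bases $B_1,B_2$ and signed circuit $\mathbf C\in\mathcal C$ such that $\mathbf C(x)\in\mathbf F(B_1,\beta(B_1))(x)$ and $-\mathbf C(x)\in\mathbf F(B_2,\beta(B_2))(x)$ for all $x$ in the support of $\mathbf C$. For $X\subseteq E$, the superscript $X$ on a vector indexed by $E$ or by $E\cup E^*$ means that its entries at the elements of $X$, respectively $X\cup X^*$, are negated; let $\mathcal C^X=\{\mathbf C^X:\mathbf C\in\mathcal C\}$ (the reorientation of $\mathcal C$ on $X$, again a regular orthogonal representation of $M$), $\sigma^X=\{\mathbf C^X:\mathbf C\in\sigma\}$ and $\beta^X(B)=\beta(B)^X$.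 **Theorem B.** Let $\mathcal C$ be a regular orthogonal representation of a regular orthogonal matroid $M$. 1. There is a well-defined action of the group $\mathrm{Jac}(\mathcal C)$ on $\mathcal R(\mathcal C)$ such that $[\mathbf v]\cdot[\mathbf O_1]=[\mathbf O_2]$ if and only if $\mathbf O_2-(\mathbf v+\mathbf O_1)\in\langle\pi(\mathcal C)\rangle$, for all $\mathbf v\in\mathbb Z^E$ and $\mathbf O_1,\mathbf O_2\in\mathcal O$. This action is simply transitive. 2. If $\sigma$ is an acyclic circuit signature, then $\beta_\sigma$ is triangulating and $\bar\beta_\sigma:\mathcal B(M)\to\mathcal R(\mathcal C)$ is a bijection. More generally, if $\beta$ is a triangulating map, then $\bar\beta:\mathcal B(M)\to\mathcal R(\mathcal C)$ is a bijection, and hence $\Gamma_\beta(j,B)=\bar\beta^{-1}(j\cdot\bar\beta(B))$ is a simply transitive action of $\mathrm{Jac}(\mathcal C)$ on $\mathcal B(M)$. 3. Let $X\subseteq E$. There are a group isomorphism $\varphi:\mathrm{Jac}(\mathcal C)\to\mathrm{Jac}(\mathcal C^X)$ with $\varphi([\mathbf v])=[\mathbf v^X]$ and a bijection $\rho:\mathcal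 R(\mathcal C)\to\mathcal R(\mathcal C^X)$ with $\rho([\mathbf O])=[\mathbf O^X]$, and they satisfy $\rho(j\cdot r)=\varphi(j)\cdot\rho(r)$. If $\beta$ is triangulating for $\mathcal C$, then $\beta^X$ is triangulating for $\mathcal C^X$, $\overline{\beta^X}=\rho\circ\bar\beta$, and $\Gamma_{\beta^X}(\varphi(j),B)=\Gamma_\beta(j,B)$ for all $j\in\mathrm{Jac}(\mathcal C)$ and $B\in\mathcal B(M)$. If $\sigma$ is an acyclic circuit signature of $\mathcal C$, then $\sigma^X$ is an acyclic circuit signature of $\mathcal C^X$, $\beta_{\sigma^X}=(\beta_\sigma)^X$, and $\Gamma_{\beta_{\sigma^X}}(\varphi(j),B)=\Gamma_{\beta_\sigma}(j,B)$ for all $j$ and $B$. -/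

import Mathlib

open scoped symmDiff

/-! ### Orthogonal matroids -/

/-- The ground set `E ∪ E*`: `Sum.inl e` is the element `e` of `E`, `Sum.inr e` is `e*`. -/
abbrev GroundSet (E : Type*) : Type _ := E ⊕ E

/-- The involution `e ↦ e*` of `E ∪ E*`. -/
def gstar {E : Type*} (x : GroundSet E) : GroundSet E := Sum.swap x

/-- The unique element of `E ∩ {x, x*}`. -/
def gunder {E : Type*} (x : GroundSet E) : E := Sum.elim id id x

/-- A transversal: a subset of `E ∪ E*` with `|E|` elements that contains no skew pair. -/
def IsTransversal {E : Type*} [Fintype E] (T : Finset (GroundSet E)) : Prop :=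
  T.card = Fintype.card E ∧ ∀ x ∈ T, gstar x ∉ T

/-- A subtransversal: a subset of a transversal. -/
def IsSubtransversal {E : Type*} [Fintype E] (S : Finset (GroundSet E)) : Prop :=
  ∃ T, IsTransversal T ∧ S ⊆ T

/-- An orthogonal matroid on `E ∪ E*`, given by its bases. -/
structure OrthogonalMatroid (E : Type*) [Fintype E] [DecidableEq E] where
  /-- the set of bases -/
  bases : Set (Finset (GroundSet E))
  bases_nonempty : bases.Nonempty
  isTransversal : ∀ B ∈ bases, IsTransversal B
  exchange : ∀ B ∈ bases, ∀ B' ∈ bases, ∀ e ∈ B \ B',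
    ∃ f ∈ B \ B', f ≠ e ∧ B ∆ {e, gstar e, f, gstar f} ∈ bases

namespace OrthogonalMatroid

variable {E : Type*} [Fintype E] [DecidableEq E]

/-- The type of bases of `M`. -/
abbrev Basis (M : OrthogonalMatroid E) : Type _ := {B : Finset (GroundSet E) // B ∈ M.bases}

/-- A circuit: a minimal subtransversal that is not contained in any basis. -/
def IsCircuit (M : OrthogonalMatroid E) (K : Finset (GroundSet E)) : Prop :=
  Minimal (fun S => IsSubtransversal S ∧ ∀ B ∈ M.bases, ¬ S ⊆ B) K

/-- `K` is the fundamental circuit `FC(B, e)` of the basis `B` and the element `e ∉ B`, that is,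
the circuit contained in `B ∆ {e, e*}`. -/
def IsFundamentalCircuit (M : OrthogonalMatroid E) (B : M.Basis) (e : GroundSet E)
    (K : Finset (GroundSet E)) : Prop :=
  M.IsCircuit K ∧ K ⊆ B.1 ∆ {e, gstar e}

end OrthogonalMatroid

/-! ### Regular orthogonal representations -/

/-- The support of an integer vector indexed by `E ∪ E*`. -/
def vsupp {E : Type*} [Fintype E] (D : GroundSet E → ℤ) : Finset (GroundSet E) :=
  Finset.univ.filter fun x => D x ≠ 0

/-- A regular orthogonal representation of `M`: a set, closed under negation, of
`(0, ±1)`-vectors, whose supports are exactly the circuits of `M`, such that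
`∑ x, C x * D x* = 0` for any two members `C`, `D`. The members are the signed circuits.
(Each such sum has summands in `{0, 1, -1}`, so if it vanishes, then all its summands are `0`
or both `1` and `-1` occur among them: the set is an oriented orthogonal matroid.) -/
structure RegularRepresentation {E : Type*} [Fintype E] [DecidableEq E]
    (M : OrthogonalMatroid E) where
  /-- the set of signed circuits -/
  circuits : Set (GroundSet E → ℤ)
  entries : ∀ D ∈ circuits, ∀ x, D x = 0 ∨ D x = 1 ∨ D x = -1
  neg_mem : ∀ D ∈ circuits, -D ∈ circuits
  image_vsupp : vsupp '' circuits = {K | M.IsCircuit K}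
  orthogonal : ∀ C ∈ circuits, ∀ D ∈ circuits, ∑ x, C x * D (gstar x) = 0

/-- The map `π` from vectors on `E ∪ E*` to vectors on `E`, `π(v)(e) = v(e) + v(e*)`. -/
def gproj {E : Type*} (v : GroundSet E → ℤ) : E → ℤ := fun e => v (Sum.inl e) + v (Sum.inr e)

/-- A vector of integers regarded as a vector of rational numbers. -/
def toRat {E : Type*} (v : E → ℤ) : E → ℚ := fun e => (v e : ℚ)

/-- Orientations: the elements of `{1/2, -1/2}^E`. -/
abbrev EOrientation (E : Type*) : Type _ := {O : E → ℚ // ∀ e, O e = 1 / 2 ∨ O e = -1 / 2}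

/-- The reorientation on `X` of a vector indexed by `E`. -/
def flipOn {E : Type*} [DecidableEq E] {R : Type*} [Neg R] (X : Finset E) (v : E → R) : E → R :=
  fun e => if e ∈ X then -v e else v e

/-- The reorientation on `X` of a vector indexed by `E ∪ E*`. -/
def gflip {E : Type*} [DecidableEq E] (X : Finset E) (D : GroundSet E → ℤ) : GroundSet E → ℤ :=
  fun x => if gunder x ∈ X then -D x else D x

/-- The reorientation on `X` of an orientation. -/
def EOrientation.flip {E : Type*} [DecidableEq E] (X : Finset E) (O : EOrientation E) :
    EOrientation E :=
  ⟨flipOn X O.1, fun e => by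
    unfold flipOn
    rcases O.2 e with h | h <;> split_ifs <;> simp [h] <;> norm_num⟩

namespace RegularRepresentation

variable {E : Type*} [Fintype E] [DecidableEq E] {M : OrthogonalMatroid E}

/-- The subgroup of `ℤ^E` generated by the vectors `π(C)`, where `C` is a signed circuit. -/
def lattice (C : RegularRepresentation M) : AddSubgroup (E → ℤ) :=
  AddSubgroup.closure (gproj '' C.circuits)

/-- The Jacobian group. -/
abbrev Jac (C : RegularRepresentation M) : Type _ := (E → ℤ) ⧸ C.lattice

/-- The equivalence relation on `ℚ^E` given by congruence modulo the subgroup generated by the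
vectors `π(C)`. -/
def JEquiv (C : RegularRepresentation M) (v w : E → ℚ) : Prop :=
  ∃ u ∈ C.lattice, w - v = toRat u

/-- `O₂` arises from `O₁` by one circuit reversal. -/
def Reversal (C : RegularRepresentation M) (O₁ O₂ : EOrientation E) : Prop :=
  ∃ D ∈ C.circuits, O₂.1 = O₁.1 + toRat (gproj D)

theorem Reversal.symm {C : RegularRepresentation M} {O₁ O₂ : EOrientation E}
    (h : C.Reversal O₁ O₂) : C.Reversal O₂ O₁ := by
  obtain ⟨D, hD, h⟩ := h
  refine ⟨-D, C.neg_mem D hD, ?_⟩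
  rw [h]
  funext e
  simp [toRat, gproj]
  ring

/-- Two orientations are equivalent if the second one arises from the first one by a sequence of
circuit reversals. -/
def reversalSetoid (C : RegularRepresentation M) : Setoid (EOrientation E) where
  r := Relation.ReflTransGen C.Reversal
  iseqv := ⟨fun _ => Relation.ReflTransGen.refl,
    fun h => by
      have hs : Std.Symm C.Reversal := ⟨fun _ _ h => h.symm⟩
      exact Std.Symm.symm _ _ h,
    fun h₁ h₂ => h₁.trans h₂⟩

/-- The circuit reversal system: the set of circuit reversal classes of orientations. -/
def ReversalSystem (C : RegularRepresentation M) : Type _ := Quotient C.reversalSetoid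

/-- The class of the integer vector `v` in the Jacobian group. -/
def jacClass (C : RegularRepresentation M) (v : E → ℤ) : C.Jac := QuotientAddGroup.mk v

/-- The circuit reversal class of an orientation. -/
def revClass (C : RegularRepresentation M) (O : EOrientation E) : C.ReversalSystem :=
  Quotient.mk C.reversalSetoid O

theorem vsupp_gflip (X : Finset E) (D : GroundSet E → ℤ) : vsupp (gflip X D) = vsupp D := by
  ext x
  simp only [vsupp, Finset.mem_filter, Finset.mem_univ, true_and]
  unfold gflip
  split_ifs <;> simp

/-- The reorientation of a regular orthogonal representation on `X ⊆ E`; it is again a regular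
orthogonal representation of the same orthogonal matroid. -/
def reorient (C : RegularRepresentation M) (X : Finset E) : RegularRepresentation M where
  circuits := gflip X '' C.circuits
  entries := by
    rintro _ ⟨D, hD, rfl⟩ x
    unfold gflip
    rcases C.entries D hD x with h | h | h <;> split_ifs <;> simp [h]
  neg_mem := by
    rintro _ ⟨D, hD, rfl⟩
    refine ⟨-D, C.neg_mem D hD, ?_⟩
    funext x
    simp only [gflip, Pi.neg_apply]
    split_ifs <;> rfl
  image_vsupp := by
    rw [← C.image_vsupp, Set.image_image]
    simp only [vsupp_gflip]
  orthogonal := by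
    rintro _ ⟨D₁, h₁, rfl⟩ _ ⟨D₂, h₂, rfl⟩
    rw [← C.orthogonal D₁ h₁ D₂ h₂]
    refine Finset.sum_congr rfl fun x _ => ?_
    have hx : gunder (gstar x) = gunder x := by cases x <;> rfl
    simp only [gflip, hx]
    split_ifs <;> ring

end RegularRepresentation

/-! ### Fourientations and triangulating maps -/

/-- A fourientation: a map from `E ∪ E*` to the subsets of `{1, -1}`. -/
abbrev Fourientation (E : Type*) : Type _ := GroundSet E → Set ℤˣ

namespace Fourientation

variable {E : Type*}

/-- The fourientation `-F`. -/
def opposite (F : Fourientation E) : Fourientation E := fun x => {s | -s ∈ F x}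

/-- The fourientation `F ∩ G`. -/
def inter (F G : Fourientation E) : Fourientation E := fun x => F x ∩ G x

/-- A `(0, ±1)`-vector is contained in `F` if each of its nonzero entries `D x` lies in `F x`. -/
def Contains (F : Fourientation E) (D : GroundSet E → ℤ) : Prop :=
  ∀ x, ∀ s : ℤˣ, D x = (s : ℤ) → s ∈ F x

open Classical in
/-- The fourientation `F(B, O)`: elements of `B` are bi-oriented, and the other elements are
oriented according to `O`. -/
noncomputable def ofBasis (B : Finset (GroundSet E)) (O : EOrientation E) : Fourientation E :=
  fun x => if x ∈ B then Set.univ else if 0 < O.1 (gunder x) then {1} else {-1}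

end Fourientation

namespace RegularRepresentation

variable {E : Type*} [Fintype E] [DecidableEq E] {M : OrthogonalMatroid E}

/-- A map from bases to orientations is triangulating if, for any two bases `B₁` and `B₂`, the
fourientation `F(B₁, β(B₁)) ∩ -F(B₂, β(B₂))` contains no signed circuit. -/
def IsTriangulating (C : RegularRepresentation M) (β : M.Basis → EOrientation E) : Prop :=
  ∀ B₁ B₂ : M.Basis, ∀ D ∈ C.circuits,
    ¬ ((Fourientation.ofBasis B₁.1 (β B₁)).inter
        (Fourientation.ofBasis B₂.1 (β B₂)).opposite).Contains D

/-- The map from bases to circuit reversal classes that `β` induces. -/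
def betaBar (C : RegularRepresentation M) (β : M.Basis → EOrientation E) :
    M.Basis → C.ReversalSystem :=
  fun B => C.revClass (β B)

/-! ### Circuit signatures -/

/-- A circuit signature: a set of signed circuits that contains exactly one of `D` and `-D` for
each signed circuit `D`. -/
def IsSignature (C : RegularRepresentation M) (σ : Set (GroundSet E → ℤ)) : Prop :=
  σ ⊆ C.circuits ∧ ∀ D ∈ C.circuits, Xor (D ∈ σ) (-D ∈ σ)

/-- A circuit signature is acyclic if a linear combination of its members with nonnegative real
coefficients vanishes only if all the coefficients do. -/
def IsAcyclicSignature (C : RegularRepresentation M) (σ : Set (GroundSet E → ℤ)) : Prop :=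
  C.IsSignature σ ∧
    ∀ (s : Finset (GroundSet E → ℤ)) (c : (GroundSet E → ℤ) → ℝ), (s : Set _) ⊆ σ →
      (∀ D ∈ s, 0 ≤ c D) → (∀ x, ∑ D ∈ s, c D * (D x : ℝ) = 0) → ∀ D ∈ s, c D = 0

end RegularRepresentation

namespace OrthogonalMatroid

variable {E : Type*} [Fintype E] [DecidableEq E]

/-- The unique element of `{e, e*}` outside the basis `B`. -/
def Basis.outside {M : OrthogonalMatroid E} (B : M.Basis) (e : E) : GroundSet E :=
  if Sum.inl e ∈ B.1 then Sum.inr e else Sum.inl e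

open Classical in
/-- The map from bases to orientations given by a circuit signature `σ`: with `e'` the element of
`{e, e*}` outside `B`, and `D` the unique member of `σ` whose support is the fundamental circuit
`FC(B, e')`, the value at `e` is `1/2` if `D e' = 1` and `-1/2` otherwise, that is, if
`D e' = -1`. -/
noncomputable def betaSig (M : OrthogonalMatroid E) (σ : Set (GroundSet E → ℤ)) :
    M.Basis → EOrientation E :=
  fun B => ⟨fun e =>
    if ∃ D ∈ σ, M.IsFundamentalCircuit B (B.outside e) (vsupp D) ∧ D (B.outside e) = 1
    then 1 / 2 else -1 / 2, fun e => by dsimp only; split_ifs <;> simp⟩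

end OrthogonalMatroid

/-- An action of an additive group is simply transitive if for any two points exactly one group
element takes the first to the second. -/
def IsSimplyTransitive {G P : Type*} [AddGroup G] (a : AddAction G P) : Prop :=
  ∀ p q : P, ∃! g : G, a.vadd g p = q

/-! Let P be the module of vectors orthogonal to all signed circuits under the pairing `∑ x, v x * w
(gstar x)`. For every basis B, the fundamental circuits, scaled to be 1 at their element outside B,
form a basis of P over any commutative ring; the coordinates of v are its entries off B
(`eq_sum_fundVec`). So P is spanned by circuits and isotropic, and over an ordered ring `∑ e, v e *
v e* = 0` on P (`sum_inl_mul_inr_eq_zero`). Most of the proof exploits this identity: if no product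
`v e * v e*` is positive, all of them vanish, so v has a subtransversal as support, and if v is
nonzero, some signed circuit has the signs of v on its own support (`exists_conformal_circuit`).

Three facts follow. First, orientations congruent modulo the lattice differ by π(v) with v in P
integral and all entries of π(v) at most 1 in absolute value. Then no product is positive, and
peeling off conformal circuits connects the two by reversals. Thus reversal classes embed into the
Jacobian group (`revToJac_injective`).

Second, the order of the Jacobian group is the determinant of the projected fundamental circuits.
Its multilinear expansion has one term per transversal, equal to 1 if the complementary transversal
is a basis and 0 otherwise (`card_jac`).

Third, a triangulating map is injective on classes (`betaBar_injective`). If two of its orientations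
are congruent but different, a circuit conformal to their difference violates the hypothesis. If
they are equal, the violating circuit comes from an optimal strategy in a skew-symmetric matrix game
(`exists_circuit_of_ne`).

Hence the injections from bases to reversal classes to the Jacobian group, whose ends have equal
finite size, are bijections. An acyclic signature always exists, so the second one is bijective
unconditionally. Both actions are translation in the Jacobian group, transported along these
bijections. -/

/-! ### Transversals and the involution -/

theorem gstar_gstar {E : Type*} (x : GroundSet E) : gstar (gstar x) = x := by
  cases x <;> rfl

theorem gstar_ne {E : Type*} (x : GroundSet E) : gstar x ≠ x := by
  cases x <;> simp [gstar]

theorem gunder_gstar {E : Type*} (x : GroundSet E) : gunder (gstar x) = gunder x := by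
  cases x <;> rfl

theorem gunder_eq_gunder {E : Type*} {x y : GroundSet E} :
    gunder x = gunder y ↔ x = y ∨ x = gstar y := by
  cases x <;> cases y <;> simp [gunder, gstar]

theorem gstar_injective {E : Type*} : Function.Injective (gstar : GroundSet E → GroundSet E) :=
  fun x y h => by rw [← gstar_gstar x, h, gstar_gstar]

theorem mem_vsupp {E : Type*} [Fintype E] {D : GroundSet E → ℤ} {x : GroundSet E} :
    x ∈ vsupp D ↔ D x ≠ 0 := by
  simp [vsupp]

namespace IsTransversal

variable {E : Type*} [Fintype E] {T : Finset (GroundSet E)}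

theorem gunder_injOn (hT : IsTransversal T) : Set.InjOn gunder (T : Set (GroundSet E)) := by
  intro x hx y hy h
  rcases gunder_eq_gunder.1 h with h | h
  · exact h
  · subst h
    exact absurd hx (hT.2 y hy)

theorem gstar_mem_iff [DecidableEq E] (hT : IsTransversal T) (x : GroundSet E) : gstar x ∈ T ↔ x ∉ T := by
  refine ⟨fun h h' => hT.2 x h' h, fun h => ?_⟩
  have hu : T.image gunder = Finset.univ :=
    Finset.eq_univ_of_card _ ((Finset.card_image_of_injOn hT.gunder_injOn).trans hT.1)
  obtain ⟨y, hy, hyx⟩ := Finset.mem_image.1 (hu ▸ Finset.mem_univ (gunder x))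
  rcases gunder_eq_gunder.1 hyx with rfl | rfl
  · exact absurd hy h
  · exact hy

theorem eq_of_subset {T' : Finset (GroundSet E)} (hT : IsTransversal T) (hT' : IsTransversal T')
    (h : T ⊆ T') : T = T' :=
  Finset.eq_of_subset_of_card_le h (hT.1.trans hT'.1.symm).ge

/-- A set that contains exactly one element of each pair `{x, x*}` is a transversal. -/
theorem of_gstar_mem_iff [DecidableEq E] (h : ∀ x, gstar x ∈ T ↔ x ∉ T) : IsTransversal T := by
  refine ⟨?_, fun x hx hx' => (h x).1 hx' hx⟩
  have hinj : Set.InjOn gunder (T : Set (GroundSet E)) := by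
    intro x hx y hy hxy
    rcases gunder_eq_gunder.1 hxy with h' | h'
    · exact h'
    · subst h'
      exact absurd hy ((h y).1 hx)
  rw [← Finset.card_image_of_injOn hinj]
  refine (congrArg _ (Finset.eq_univ_of_forall fun e => ?_)).trans Finset.card_univ
  by_cases he : Sum.inl e ∈ T
  · exact Finset.mem_image.2 ⟨_, he, rfl⟩
  · exact Finset.mem_image.2 ⟨_, (h _).2 he, rfl⟩

end IsTransversal

theorem isSubtransversal_of_forall {E : Type*} [Fintype E] [DecidableEq E]
    {S : Finset (GroundSet E)} (h : ∀ x ∈ S, gstar x ∉ S) : IsSubtransversal S := by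
  classical
  -- A pair disjoint from S contributes its element in the left copy of E.
  refine ⟨Finset.univ.filter fun x => x ∈ S ∨ (gstar x ∉ S ∧ x.isLeft), ?_, fun x hx => by
    simp [hx]⟩
  refine IsTransversal.of_gstar_mem_iff fun x => ?_
  simp only [Finset.mem_filter, Finset.mem_univ, true_and, gstar_gstar]
  have h1 := h x
  have h2 : (gstar x).isLeft = !x.isLeft := by cases x <;> rfl
  rw [h2]
  by_cases hx : x ∈ S <;> by_cases hx' : gstar x ∈ S <;> simp_all

theorem IsSubtransversal.gstar_notMem {E : Type*} [Fintype E]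
    {S : Finset (GroundSet E)} (h : IsSubtransversal S) {x : GroundSet E} (hx : x ∈ S) :
    gstar x ∉ S := by
  obtain ⟨T, hT, hST⟩ := h
  exact fun h' => hT.2 x (hST hx) (hST h')

/-! ### Bases and fundamental circuits -/

namespace OrthogonalMatroid

variable {E : Type*} [Fintype E] [DecidableEq E] {M : OrthogonalMatroid E}

theorem exists_isCircuit_subset {S : Finset (GroundSet E)} (hS : IsSubtransversal S)
    (h : ∀ B ∈ M.bases, ¬ S ⊆ B) : ∃ K ⊆ S, M.IsCircuit K :=
  exists_minimal_le_of_wellFoundedLT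
    (fun S => IsSubtransversal S ∧ ∀ B ∈ M.bases, ¬ S ⊆ B) S ⟨hS, h⟩

namespace Basis

theorem gunder_outside (B : M.Basis) (e : E) : gunder (B.outside e) = e := by
  unfold outside
  split_ifs <;> rfl

theorem outside_notMem (B : M.Basis) (e : E) : B.outside e ∉ B.1 := by
  unfold outside
  split_ifs with h
  · exact (M.isTransversal _ B.2).2 _ h
  · exact h

theorem gstar_mem_iff (B : M.Basis) (x : GroundSet E) : gstar x ∈ B.1 ↔ x ∉ B.1 :=
  (M.isTransversal _ B.2).gstar_mem_iff x

theorem outside_gunder (B : M.Basis) {x : GroundSet E} (hx : x ∉ B.1) :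
    B.outside (gunder x) = x := by
  rcases gunder_eq_gunder.1 (B.gunder_outside (gunder x)) with h | h
  · exact h
  · exact absurd ((B.gstar_mem_iff x).2 hx) (h ▸ B.outside_notMem _)

theorem outside_injective (B : M.Basis) : Function.Injective B.outside := fun e f h => by
  rw [← B.gunder_outside e, h, B.gunder_outside]

theorem mem_symmDiff_iff (B : M.Basis) {e : GroundSet E} (he : e ∉ B.1) (x : GroundSet E) :
    x ∈ B.1 ∆ {e, gstar e} ↔ (x ∈ B.1 ∧ x ≠ gstar e) ∨ x = e := by
  have h := (B.gstar_mem_iff e).2 he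
  simp only [Finset.mem_symmDiff, Finset.mem_insert, Finset.mem_singleton]
  constructor
  · rintro (⟨h1, h2⟩ | ⟨rfl | rfl, h2⟩)
    · exact Or.inl ⟨h1, fun h => h2 (Or.inr h)⟩
    · exact Or.inr rfl
    · exact absurd h h2
  · rintro (⟨h1, h2⟩ | rfl)
    · exact Or.inl ⟨h1, fun h' => h'.elim (fun h' => he (h' ▸ h1)) h2⟩
    · exact Or.inr ⟨Or.inl rfl, he⟩

theorem isTransversal_symmDiff (B : M.Basis) {e : GroundSet E} (he : e ∉ B.1) :
    IsTransversal (B.1 ∆ {e, gstar e}) := by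
  refine IsTransversal.of_gstar_mem_iff fun x => ?_
  rw [B.mem_symmDiff_iff he, B.mem_symmDiff_iff he, B.gstar_mem_iff]
  have h1 : gstar x = gstar e ↔ x = e := gstar_injective.eq_iff
  have h2 : gstar x = e ↔ x = gstar e :=
    ⟨fun h => by rw [← h, gstar_gstar], fun h => by rw [h, gstar_gstar]⟩
  rw [Ne, h1, h2]
  have h3 := (B.gstar_mem_iff e).2 he
  by_cases hxe : x = e
  · subst hxe
    simp [he, (gstar_ne x).symm]
  · by_cases hxe' : x = gstar e
    · subst hxe'
      simp [hxe]
    · simp [hxe, hxe']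

/-- Two bases cannot differ in a single pair: exchange would need a second element of the
difference, which consists of `gstar e` alone. -/
theorem symmDiff_notMem_bases (B : M.Basis) {e : GroundSet E} (he : e ∉ B.1) :
    B.1 ∆ {e, gstar e} ∉ M.bases := by
  intro h
  have hs := (B.gstar_mem_iff e).2 he
  have hmem : ∀ f ∈ B.1 \ (B.1 ∆ {e, gstar e}), f = gstar e := by
    intro f hf
    rw [Finset.mem_sdiff, B.mem_symmDiff_iff he] at hf
    by_contra hne
    exact hf.2 (Or.inl ⟨hf.1, hne⟩)
  obtain ⟨f, hf, hfe, -⟩ := M.exchange B.1 B.2 _ h (gstar e) (by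
    rw [Finset.mem_sdiff, B.mem_symmDiff_iff he]
    exact ⟨hs, by simp [gstar_ne]⟩)
  exact hfe (hmem f hf)

theorem exists_isFundamentalCircuit (B : M.Basis) {e : GroundSet E} (he : e ∉ B.1) :
    ∃ K, M.IsFundamentalCircuit B e K := by
  have hT := B.isTransversal_symmDiff he
  obtain ⟨K, hK, hK'⟩ := exists_isCircuit_subset (M := M) ⟨_, hT, subset_rfl⟩
    fun B' hB' h => B.symmDiff_notMem_bases he
      (hT.eq_of_subset (M.isTransversal _ hB') h ▸ hB')
  exact ⟨K, hK', hK⟩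

end Basis

end OrthogonalMatroid

/-! ### Vectors orthogonal to all signed circuits -/

namespace RegularRepresentation

variable {E : Type*} [Fintype E] [DecidableEq E] {M : OrthogonalMatroid E}
  (C : RegularRepresentation M)

theorem isCircuit_vsupp {D : GroundSet E → ℤ} (hD : D ∈ C.circuits) : M.IsCircuit (vsupp D) :=
  C.image_vsupp.subset ⟨D, hD, rfl⟩

theorem exists_vsupp_eq {K : Finset (GroundSet E)} (hK : M.IsCircuit K) :
    ∃ D ∈ C.circuits, vsupp D = K :=
  C.image_vsupp.superset hK

theorem apply_gstar_eq_zero {D : GroundSet E → ℤ} (hD : D ∈ C.circuits) {x : GroundSet E}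
    (hx : D x ≠ 0) : D (gstar x) = 0 := by
  by_contra h
  exact (C.isCircuit_vsupp hD).prop.1.gstar_notMem (mem_vsupp.2 hx) (mem_vsupp.2 h)

theorem exists_notMem_basis {D : GroundSet E → ℤ} (hD : D ∈ C.circuits) (B : M.Basis) :
    ∃ x, D x ≠ 0 ∧ x ∉ B.1 := by
  obtain ⟨x, hx, hxB⟩ := Finset.not_subset.1 ((C.isCircuit_vsupp hD).prop.2 B.1 B.2)
  exact ⟨x, mem_vsupp.1 hx, hxB⟩

theorem exists_fundamental (B : M.Basis) (e : E) :
    ∃ D ∈ C.circuits, D (B.outside e) = 1 ∧ ∀ x, D x ≠ 0 → x ∈ B.1 ∨ x = B.outside e := by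
  obtain ⟨K, hK, hKB⟩ := B.exists_isFundamentalCircuit (B.outside_notMem e)
  obtain ⟨D, hD, rfl⟩ := C.exists_vsupp_eq hK
  have hsupp : ∀ x, D x ≠ 0 → x ∈ B.1 ∨ x = B.outside e := fun x hx =>
    ((B.mem_symmDiff_iff (B.outside_notMem e) x).1 (hKB (mem_vsupp.2 hx))).imp_left And.left
  obtain ⟨x, hx, hxB⟩ := C.exists_notMem_basis hD B
  obtain rfl := (hsupp x hx).resolve_left hxB
  rcases C.entries D hD (B.outside e) with h | h | h
  · exact absurd h hx
  · exact ⟨D, hD, h, hsupp⟩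
  · exact ⟨-D, C.neg_mem D hD, by simp [h], fun x hx => hsupp x (by simpa using hx)⟩

/-- The signed circuit supported on the fundamental circuit of `B` and the element `e'` of
`{e, e*}` outside `B`, normalized to have the value `1` at `e'`. -/
noncomputable def fundVec (B : M.Basis) (e : E) : GroundSet E → ℤ :=
  (C.exists_fundamental B e).choose

theorem fundVec_mem (B : M.Basis) (e : E) : C.fundVec B e ∈ C.circuits :=
  (C.exists_fundamental B e).choose_spec.1

theorem fundVec_outside_self (B : M.Basis) (e : E) : C.fundVec B e (B.outside e) = 1 :=
  (C.exists_fundamental B e).choose_spec.2.1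

theorem fundVec_eq_zero (B : M.Basis) (e : E) {x : GroundSet E} (hx : x ∉ B.1)
    (hx' : x ≠ B.outside e) : C.fundVec B e x = 0 := by
  by_contra h
  exact ((C.exists_fundamental B e).choose_spec.2.2 x h).elim hx hx'

theorem fundVec_outside (B : M.Basis) (e f : E) :
    C.fundVec B e (B.outside f) = if e = f then 1 else 0 := by
  split_ifs with h
  · rw [h, fundVec_outside_self]
  · exact C.fundVec_eq_zero B e (B.outside_notMem f) fun h' => h (B.outside_injective h'.symm)

/-- The vectors over `R` that are orthogonal to all signed circuits. -/
def perp (R : Type*) [CommRing R] : Submodule R (GroundSet E → R) where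
  carrier := {v | ∀ D ∈ C.circuits, ∑ x, v x * (D (gstar x) : R) = 0}
  add_mem' := fun {v w} hv hw D hD => by
    simp only [Pi.add_apply, add_mul, Finset.sum_add_distrib, hv D hD, hw D hD, add_zero]
  zero_mem' := fun D _ => by simp
  smul_mem' := fun c v hv D hD => by
    simp only [Pi.smul_apply, smul_eq_mul, mul_assoc, ← Finset.mul_sum, hv D hD, mul_zero]

section perp

variable {R : Type*} [CommRing R]

theorem cast_mem_perp {v : GroundSet E → ℤ} (hv : v ∈ C.perp ℤ) :
    (fun x => (v x : R)) ∈ C.perp R := fun D hD => by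
  have := congrArg (Int.cast : ℤ → R) (hv D hD)
  push_cast at this
  simpa using this

theorem circuit_mem_perp_int {D : GroundSet E → ℤ} (hD : D ∈ C.circuits) : D ∈ C.perp ℤ :=
  fun D' hD' => by simpa using C.orthogonal D hD D' hD'

theorem circuit_mem_perp {D : GroundSet E → ℤ} (hD : D ∈ C.circuits) :
    (fun x => (D x : R)) ∈ C.perp R :=
  C.cast_mem_perp (C.circuit_mem_perp_int hD)

/-- For x in B, pair v with the fundamental circuit of `gstar x`. Off `gstar x` this circuit lives
on B, whose partners lie where v vanishes, so only the summand `v x` survives. -/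
theorem eq_zero_of_mem_perp (B : M.Basis) {v : GroundSet E → R} (hv : v ∈ C.perp R)
    (h : ∀ x, x ∉ B.1 → v x = 0) : v = 0 := by
  funext x
  by_cases hx : x ∈ B.1
  · have hx' : gstar x ∉ B.1 := fun h' => (B.gstar_mem_iff x).1 h' hx
    have := hv _ (C.fundVec_mem B (gunder x))
    have ho : B.outside (gunder x) = gstar x := by
      rw [← gunder_gstar, B.outside_gunder hx']
    rw [Finset.sum_eq_single x] at this
    · rw [← ho, fundVec_outside_self] at this
      simpa using this
    · intro y _ hyx
      by_cases hy : y ∈ B.1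
      · rw [C.fundVec_eq_zero B _ (fun h' => (B.gstar_mem_iff y).1 h' hy)
          (by rw [ho]; exact fun h' => hyx (gstar_injective h'))]
        simp
      · rw [h y hy, zero_mul]
    · simp
  · exact h x hx

/-- Both sides lie in `perp` and agree off B, so `eq_zero_of_mem_perp` applies to their difference.
No division occurs, which gives integral coordinates when R is ℤ. -/
theorem eq_sum_fundVec (B : M.Basis) {v : GroundSet E → R} (hv : v ∈ C.perp R)
    (x : GroundSet E) : v x = ∑ e, v (B.outside e) * (C.fundVec B e x : R) := by
  have hsum : (∑ e, v (B.outside e) • fun x => (C.fundVec B e x : R)) ∈ C.perp R :=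
    Submodule.sum_mem _ fun e _ =>
      Submodule.smul_mem _ _ (C.circuit_mem_perp (C.fundVec_mem B e))
  have h := C.eq_zero_of_mem_perp B (Submodule.sub_mem _ hv hsum) fun x hx => by
    rw [← B.outside_gunder hx]
    simp [Finset.sum_apply, fundVec_outside]
  have := congrFun h x
  simp only [Pi.sub_apply, Finset.sum_apply, Pi.smul_apply, smul_eq_mul, Pi.zero_apply] at this
  exact sub_eq_zero.1 this

/-- Expanding w in fundamental circuits reduces the pairing to v against signed circuits. -/
theorem sum_mul_gstar_eq_zero {v w : GroundSet E → R} (hv : v ∈ C.perp R) (hw : w ∈ C.perp R) :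
    ∑ x, v x * w (gstar x) = 0 := by
  obtain ⟨B⟩ : Nonempty M.Basis := M.bases_nonempty.to_subtype
  have h : ∀ x, v x * w (gstar x) =
      ∑ e, w (B.outside e) * (v x * (C.fundVec B e (gstar x) : R)) := fun x => by
    rw [C.eq_sum_fundVec B hw (gstar x), Finset.mul_sum]
    exact Finset.sum_congr rfl fun e _ => by ring
  simp only [h]
  rw [Finset.sum_comm]
  exact Finset.sum_eq_zero fun e _ => by
    rw [← Finset.mul_sum, hv _ (C.fundVec_mem B e), mul_zero]

/-- Pairing v with itself gives twice the sum; the order on R is used to cancel the 2. -/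
theorem sum_inl_mul_inr_eq_zero [LinearOrder R] [IsStrictOrderedRing R] {v : GroundSet E → R}
    (hv : v ∈ C.perp R) :
    ∑ e, v (Sum.inl e) * v (Sum.inr e) = 0 := by
  have := C.sum_mul_gstar_eq_zero hv hv
  rw [Fintype.sum_sum_type] at this
  simp only [gstar, Sum.swap_inl, Sum.swap_inr] at this
  have h : ∑ e, v (Sum.inr e) * v (Sum.inl e) = ∑ e, v (Sum.inl e) * v (Sum.inr e) :=
    Finset.sum_congr rfl fun e _ => mul_comm _ _
  linarith

end perp

/-- A nonzero vector orthogonal to all signed circuits whose support is a subtransversal contains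
a circuit in its support. -/
theorem exists_circuit_of_mem_perp {R : Type*} [CommRing R] {v : GroundSet E → R}
    (hv : v ∈ C.perp R) (h0 : v ≠ 0) (hs : ∀ x, v x ≠ 0 → v (gstar x) = 0) :
    ∃ D ∈ C.circuits, ∀ x, D x ≠ 0 → v x ≠ 0 := by
  classical
  have hsub : IsSubtransversal (Finset.univ.filter fun x => v x ≠ 0) :=
    isSubtransversal_of_forall fun x hx => by
      simpa using hs x (by simpa using hx)
  obtain ⟨K, hK, hKc⟩ := OrthogonalMatroid.exists_isCircuit_subset (M := M) hsub
    fun B hB h => h0 (C.eq_zero_of_mem_perp ⟨B, hB⟩ hv fun x hx => by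
      by_contra hne
      exact hx (h (by simpa using hne)))
  obtain ⟨D, hD, rfl⟩ := C.exists_vsupp_eq hKc
  exact ⟨D, hD, fun x hx => by simpa using hK (mem_vsupp.2 hx)⟩

/-- Conformal decomposition: below a nonzero vector that is orthogonal to all signed circuits and
has a subtransversal as support lies a signed circuit with the same signs. -/
theorem exists_conformal_circuit {v : GroundSet E → ℝ} (hv : v ∈ C.perp ℝ) (h0 : v ≠ 0)
    (hs : ∀ x, v x ≠ 0 → v (gstar x) = 0) :
    ∃ D ∈ C.circuits, ∀ x, D x ≠ 0 → 0 < (D x : ℝ) * v x := by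
  classical
  induction hn : (Finset.univ.filter fun x => v x ≠ 0).card using Nat.strong_induction_on
    generalizing v with
  | _ n ih =>
  obtain ⟨D, hD, hDv⟩ := C.exists_circuit_of_mem_perp hv h0 hs
  obtain ⟨y, hy⟩ : ∃ y, D y ≠ 0 := by
    obtain ⟨B⟩ : Nonempty M.Basis := M.bases_nonempty.to_subtype
    exact (C.exists_notMem_basis hD B).imp fun _ h => h.1
  obtain ⟨D, hD, hDv, y, hy⟩ : ∃ D ∈ C.circuits, (∀ x, D x ≠ 0 → v x ≠ 0) ∧
      ∃ y, 0 < (D y : ℝ) * v y := by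
    have hne : (D y : ℝ) * v y ≠ 0 := mul_ne_zero (by exact_mod_cast hy) (hDv y hy)
    rcases hne.lt_or_gt with h | h
    · exact ⟨-D, C.neg_mem D hD, fun x hx => hDv x (by simpa using hx), y, by simpa using h⟩
    · exact ⟨D, hD, hDv, y, h⟩
  -- Among the entries where D and v agree in sign, z is one with v smallest in absolute value, and
  -- t is that value. Subtracting t times D kills the entry at z and reverses no sign of v: agreeing
  -- entries shrink by t, at most to zero, and opposite ones grow. A circuit conformal to the
  -- remainder w is therefore conformal to v.
  obtain ⟨z, hz, hmin⟩ := Finset.exists_min_image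
    (Finset.univ.filter fun x => 0 < (D x : ℝ) * v x) (fun x => (D x : ℝ) * v x)
    ⟨y, by simpa using hy⟩
  simp only [Finset.mem_filter, Finset.mem_univ, true_and] at hz hmin
  set t := (D z : ℝ) * v z with ht
  have hsq : ∀ x, D x ≠ 0 → (D x : ℝ) * D x = 1 := fun x hx => by
    rcases C.entries D hD x with h | h | h
    · exact absurd h hx
    · simp [h]
    · simp [h]
  have hz0 : D z ≠ 0 := fun h => by simp [ht, h] at hz
  set w : GroundSet E → ℝ := v - t • fun x => (D x : ℝ) with hw
  have hwx : ∀ x, w x = v x - t * D x := fun x => by simp [hw]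
  have hwz : w z = 0 := by
    rw [hwx, ht]
    linear_combination (-v z) * hsq z hz0
  have hwv : ∀ x, w x ≠ 0 → v x ≠ 0 := fun x hx hvx => by
    by_cases hDx : D x = 0
    · exact hx (by simp [hwx, hvx, hDx])
    · exact hDv x hDx hvx
  have hwp : w ∈ C.perp ℝ :=
    Submodule.sub_mem _ hv (Submodule.smul_mem _ _ (C.circuit_mem_perp hD))
  by_cases hw0 : w = 0
  · refine ⟨D, hD, fun x hx => ?_⟩
    have : v x = t * D x := by
      have := congrFun hw0 x
      rw [hwx] at this
      exact sub_eq_zero.1 this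
    rw [this]
    nlinarith [hsq x hx]
  · have hlt : (Finset.univ.filter fun x => w x ≠ 0).card < n := by
      rw [← hn]
      refine Finset.card_lt_card (Finset.ssubset_iff_subset_ne.2
        ⟨fun x hx => by simpa using hwv x (by simpa using hx), fun h => ?_⟩)
      have hzm : z ∈ Finset.univ.filter fun x => v x ≠ 0 := by
        simpa using hDv z hz0
      rw [← h] at hzm
      simp [hwz] at hzm
    obtain ⟨D', hD', hpos⟩ := ih _ hlt hwp hw0 (fun x hx => by
      by_contra hne
      exact hwv _ hne (hs x (hwv x hx))) rfl
    refine ⟨D', hD', fun x hx => ?_⟩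
    have h1 := hpos x hx
    have hvx : v x ≠ 0 := hwv x fun h => by simp [h] at h1
    rw [hwx] at h1
    by_cases hDx : D x = 0
    · simpa [hDx] using h1
    have hb : (D' x : ℝ) * D' x = 1 := by
      rcases C.entries D' hD' x with h | h | h
      · exact absurd h hx
      · simp [h]
      · simp [h]
    have ha := hsq x hDx
    have hm : 0 < (D x : ℝ) * v x → t ≤ (D x : ℝ) * v x := hmin x
    rcases C.entries D hD x with h | h | h
    · exact absurd h hDx
    all_goals
      rcases C.entries D' hD' x with h' | h' | h'
      · exact absurd h' hx
      all_goals
        simp only [h, h', Int.cast_one, Int.cast_neg] at h1 hm ⊢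
        rcases hvx.lt_or_gt with hlt | hgt
        · first
          | linarith
          | linarith [hm (by linarith)]
        · first
          | linarith
          | linarith [hm (by linarith)]

end RegularRepresentation

/-! ### Orientations as 0/1 vectors -/

/-- The indicator function of the positive part of an orientation. -/
def EOrientation.ind {E : Type*} (O : EOrientation E) : E → ℤ :=
  fun e => if 0 < O.1 e then 1 else 0

namespace EOrientation

variable {E : Type*}

theorem toRat_ind (O : EOrientation E) (e : E) : toRat O.ind e = O.1 e + 1 / 2 := by
  unfold toRat ind
  rcases O.2 e with h | h <;> rw [h] <;> norm_num

theorem ind_eq_or (O : EOrientation E) (e : E) : O.ind e = 0 ∨ O.ind e = 1 := by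
  unfold ind
  split_ifs <;> simp

theorem ind_injective : Function.Injective (ind : EOrientation E → E → ℤ) := fun O₁ O₂ h =>
  Subtype.ext <| funext fun e => by
    have h1 := O₁.toRat_ind e
    have h2 := O₂.toRat_ind e
    rw [h] at h1
    linarith

/-- The orientation with a given positive part. -/
def ofInd (u : E → ℤ) : EOrientation E :=
  ⟨fun e => if u e = 1 then 1 / 2 else -1 / 2, fun e => by dsimp only; split_ifs <;> simp⟩

theorem ind_ofInd {u : E → ℤ} (hu : ∀ e, u e = 0 ∨ u e = 1) : (ofInd u).ind = u := by
  funext e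
  rcases hu e with h | h <;> norm_num [ind, ofInd, h]

end EOrientation

theorem toRat_injective {E : Type*} : Function.Injective (toRat : (E → ℤ) → E → ℚ) :=
  fun u v h => funext fun e => by
    have := congrFun h e
    simpa [toRat] using this

theorem toRat_sub {E : Type*} (u v : E → ℤ) : toRat (u - v) = toRat u - toRat v := by
  funext e
  simp [toRat]

theorem toRat_add {E : Type*} (u v : E → ℤ) : toRat (u + v) = toRat u + toRat v := by
  funext e
  simp [toRat]

/-- The shift by 1/2 cancels in differences, so that congruence of orientations becomes a statement
about integer vectors. -/
theorem sub_val_eq_iff_ind {E : Type*} (O₁ O₂ : EOrientation E) (u : E → ℤ) :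
    O₂.1 - O₁.1 = toRat u ↔ O₂.ind - O₁.ind = u := by
  rw [← toRat_injective.eq_iff, toRat_sub]
  have : toRat O₂.ind - toRat O₁.ind = O₂.1 - O₁.1 := by
    funext e
    simp [EOrientation.toRat_ind]
  rw [this]

/-- The projection `gproj` as a linear map. -/
def gprojHom (E : Type*) : (GroundSet E → ℤ) →ₗ[ℤ] (E → ℤ) where
  toFun := gproj
  map_add' v w := by
    funext e
    simp only [gproj, Pi.add_apply]
    ring
  map_smul' c v := by
    funext e
    simp [gproj, mul_add]

/-! ### Circuit reversal classes inside the Jacobian group -/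

namespace RegularRepresentation

variable {E : Type*} [Fintype E] [DecidableEq E] {M : OrthogonalMatroid E}
  (C : RegularRepresentation M)

theorem gproj_mem_lattice {D : GroundSet E → ℤ} (hD : D ∈ C.circuits) : gproj D ∈ C.lattice :=
  AddSubgroup.subset_closure ⟨D, hD, rfl⟩

/-- An integral vector of `perp` is an integral combination of fundamental circuits, which are
themselves signed circuits. -/
theorem lattice_eq_map_perp : C.lattice = ((C.perp ℤ).map (gprojHom E)).toAddSubgroup := by
  refine le_antisymm ?_ ?_
  · refine (AddSubgroup.closure_le _).2 ?_
    rintro _ ⟨D, hD, rfl⟩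
    exact ⟨D, C.circuit_mem_perp_int hD, rfl⟩
  · rintro _ ⟨v, hv, rfl⟩
    obtain ⟨B⟩ : Nonempty M.Basis := M.bases_nonempty.to_subtype
    have : v = ∑ e, v (B.outside e) • C.fundVec B e := by
      funext x
      simpa using C.eq_sum_fundVec B hv x
    rw [this, map_sum]
    refine AddSubgroup.sum_mem _ fun e _ => ?_
    rw [map_smul]
    exact AddSubgroup.zsmul_mem _ (C.gproj_mem_lattice (C.fundVec_mem B e)) _

theorem mem_lattice {u : E → ℤ} : u ∈ C.lattice ↔ ∃ v ∈ C.perp ℤ, gproj v = u := by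
  rw [lattice_eq_map_perp]
  exact Iff.rfl

/-- If all entries of `π(v)` are at most `1` in absolute value, then the support of `v` is a
subtransversal. -/
theorem inl_eq_zero_or_inr_eq_zero {v : GroundSet E → ℤ} (hv : v ∈ C.perp ℤ)
    (h : ∀ e, |gproj v e| ≤ 1) (e : E) : v (Sum.inl e) = 0 ∨ v (Sum.inr e) = 0 := by
  have hle : ∀ e ∈ Finset.univ, v (Sum.inl e) * v (Sum.inr e) ≤ 0 := fun e _ => by
    have := abs_le.1 (h e)
    simp only [gproj] at this
    by_contra hpos
    -- Two nonzero integers of equal sign have a sum of absolute value at least 2.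
    rcases mul_pos_iff.1 (not_le.1 hpos) with h | h <;> omega
  have := (Finset.sum_eq_zero_iff_of_nonpos hle).1 (C.sum_inl_mul_inr_eq_zero hv) e
    (Finset.mem_univ e)
  exact mul_eq_zero.1 this

theorem reversal_of_ind {O₁ O₂ : EOrientation E} {D : GroundSet E → ℤ} (hD : D ∈ C.circuits)
    (h : O₂.ind - O₁.ind = gproj D) : C.Reversal O₁ O₂ :=
  ⟨D, hD, by rw [← (sub_val_eq_iff_ind O₁ O₂ _).2 h, add_sub_cancel]⟩

theorem Reversal.ind_sub_mem {C : RegularRepresentation M} {O₁ O₂ : EOrientation E}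
    (h : C.Reversal O₁ O₂) : O₂.ind - O₁.ind ∈ C.lattice := by
  obtain ⟨D, hD, h⟩ := h
  rw [(sub_val_eq_iff_ind O₁ O₂ (gproj D)).1 (by rw [h, add_sub_cancel_left])]
  exact C.gproj_mem_lattice hD

/-- A vector whose projection is a nonzero difference of two orientations lies above a signed
circuit with the same signs. -/
theorem exists_conformal_circuit_of_gproj {O₁ O₂ : EOrientation E} {v : GroundSet E → ℤ}
    (hv : v ∈ C.perp ℤ) (h0 : v ≠ 0) (h : O₂.ind - O₁.ind = gproj v) :
    ∃ D ∈ C.circuits, ∀ x, D x ≠ 0 → D x = v x ∧ v x = O₂.ind (gunder x) - O₁.ind (gunder x) := by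
  have hab : ∀ e, |gproj v e| ≤ 1 := fun e => by
    rw [← h, Pi.sub_apply, abs_le]
    rcases O₁.ind_eq_or e with h1 | h1 <;> rcases O₂.ind_eq_or e with h2 | h2 <;> omega
  have hz := C.inl_eq_zero_or_inr_eq_zero hv hab
  obtain ⟨D, hD, hDv⟩ := C.exists_conformal_circuit (C.cast_mem_perp (R := ℝ) hv)
    (fun h' => h0 (funext fun x => by simpa using congrFun h' x)) (by
      rintro (e | e) hx
      · simpa [gstar] using (hz e).resolve_left (by simpa using hx)
      · simpa [gstar] using (hz e).resolve_right (by simpa using hx))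
  refine ⟨D, hD, fun x hx => ?_⟩
  have hpos : 0 < D x * v x := by exact_mod_cast hDv x hx
  have hvx : v x ≠ 0 := fun h' => by simp [h'] at hpos
  have hvg : v x = gproj v (gunder x) := by
    cases x with
    | inl e =>
      have := (hz e).resolve_left hvx
      simp [gproj, gunder, this]
    | inr e =>
      have := (hz e).resolve_right hvx
      simp [gproj, gunder, this]
  refine ⟨?_, by rw [hvg, ← h, Pi.sub_apply]⟩
  have hb := abs_le.1 (hab (gunder x))
  rw [← hvg] at hb
  rcases C.entries D hD x with h' | h' | h'
  · exact absurd h' hx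
  · rw [h'] at hpos ⊢
    omega
  · rw [h'] at hpos ⊢
    omega

/-- Induction on the support of v. A signed circuit D conformal to v agrees on its support with v,
hence with the difference of the orientations. Adding π(D) thus moves some coordinates of the first
orientation all the way to the second, which is a legal reversal, and `v - D` has smaller support.
-/
theorem reflTransGen_of_gproj {O₁ O₂ : EOrientation E} {v : GroundSet E → ℤ}
    (hv : v ∈ C.perp ℤ) (h : O₂.ind - O₁.ind = gproj v) :
    Relation.ReflTransGen C.Reversal O₁ O₂ := by
  classical
  induction hn : (vsupp v).card using Nat.strong_induction_on generalizing v O₁ with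
  | _ n ih =>
  by_cases h0 : v = 0
  · have : O₁ = O₂ := EOrientation.ind_injective <| by
      rw [← sub_eq_zero, ← neg_sub, h, h0]
      funext e
      simp [gproj]
    rw [this]
  obtain ⟨D, hD, hDv⟩ := C.exists_conformal_circuit_of_gproj hv h0 h
  have hval : ∀ e, O₁.ind e + gproj D e = 0 ∨ O₁.ind e + gproj D e = 1 := fun e => by
    have hl := hDv (Sum.inl e)
    have hr := hDv (Sum.inr e)
    have hc := C.apply_gstar_eq_zero hD (x := Sum.inl e)
    simp only [gunder, gstar, Sum.elim_inl, Sum.elim_inr, id, Sum.swap_inl] at hl hr hc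
    have h1 := O₁.ind_eq_or e
    have h2 := O₂.ind_eq_or e
    simp only [gproj]
    by_cases h3 : D (Sum.inl e) = 0 <;> by_cases h4 : D (Sum.inr e) = 0
    · omega
    · have := hr h4
      omega
    · have := hl h3
      omega
    · exact absurd (hc h3) h4
  have hind : (EOrientation.ofInd (O₁.ind + gproj D)).ind = O₁.ind + gproj D :=
    EOrientation.ind_ofInd hval
  refine Relation.ReflTransGen.head (b := EOrientation.ofInd (O₁.ind + gproj D))
    (C.reversal_of_ind hD (by rw [hind, add_sub_cancel_left])) ?_
  refine ih _ ?_ (Submodule.sub_mem _ hv (C.circuit_mem_perp_int hD)) ?_ rfl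
  · rw [← hn]
    obtain ⟨B⟩ : Nonempty M.Basis := M.bases_nonempty.to_subtype
    obtain ⟨y, hy, -⟩ := C.exists_notMem_basis hD B
    refine Finset.card_lt_card (Finset.ssubset_iff_subset_ne.2 ⟨fun x hx => ?_, fun heq => ?_⟩)
    · rw [mem_vsupp] at hx ⊢
      intro hvx
      by_cases hDx : D x = 0
      · exact hx (by simp [hvx, hDx])
      · exact hDx ((hDv x hDx).1.trans hvx)
    · have : y ∈ vsupp v := mem_vsupp.2 ((hDv y hy).1 ▸ hy)
      rw [← heq, mem_vsupp] at this
      exact this (by simp [(hDv y hy).1])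
  · rw [hind, ← sub_sub, h]
    exact ((gprojHom E).map_sub v D).symm

theorem reflTransGen_reversal_iff {O₁ O₂ : EOrientation E} :
    Relation.ReflTransGen C.Reversal O₁ O₂ ↔ O₂.ind - O₁.ind ∈ C.lattice := by
  constructor
  · intro h
    induction h with
    | refl => simp
    | tail _ h ih => simpa using C.lattice.add_mem h.ind_sub_mem ih
  · intro h
    obtain ⟨v, hv, hvu⟩ := C.mem_lattice.1 h
    exact C.reflTransGen_of_gproj hv hvu.symm

theorem revClass_eq_iff {O₁ O₂ : EOrientation E} :
    C.revClass O₁ = C.revClass O₂ ↔ O₂.ind - O₁.ind ∈ C.lattice :=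
  Quotient.eq.trans C.reflTransGen_reversal_iff

/-- The embedding of the circuit reversal system into the Jacobian group. -/
def revToJac : C.ReversalSystem → C.Jac :=
  Quotient.lift (fun O => C.jacClass O.ind) fun _ _ h =>
    QuotientAddGroup.eq.2 (by
      rw [neg_add_eq_sub]
      exact C.reflTransGen_reversal_iff.1 h)

theorem revToJac_revClass (O : EOrientation E) : C.revToJac (C.revClass O) = C.jacClass O.ind :=
  rfl

theorem revClass_surjective : Function.Surjective C.revClass := Quotient.mk_surjective

theorem jacClass_surjective : Function.Surjective C.jacClass := QuotientAddGroup.mk_surjective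

theorem jacClass_eq_iff {u v : E → ℤ} : C.jacClass u = C.jacClass v ↔ v - u ∈ C.lattice := by
  rw [← neg_add_eq_sub]
  exact QuotientAddGroup.eq

theorem revToJac_injective : Function.Injective C.revToJac := fun r s h => by
  obtain ⟨O₁, rfl⟩ := C.revClass_surjective r
  obtain ⟨O₂, rfl⟩ := C.revClass_surjective s
  rw [revToJac_revClass, revToJac_revClass, jacClass_eq_iff] at h
  exact C.revClass_eq_iff.2 h

end RegularRepresentation

/-! ### The order of the Jacobian group -/

namespace OrthogonalMatroid

variable {E : Type*} [Fintype E] [DecidableEq E] {M : OrthogonalMatroid E}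

/-- The transversal that contains `e` for `e ∈ s` and `e*` for `e ∉ s`, as a choice function. -/
def choiceOf (s : Finset E) (e : E) : GroundSet E := if e ∈ s then Sum.inl e else Sum.inr e

omit [Fintype E] in
theorem gunder_choiceOf (s : Finset E) (e : E) : gunder (choiceOf s e) = e := by
  unfold choiceOf
  split_ifs <;> rfl

/-- The complement of the transversal `choiceOf s`. -/
def coTransversal (s : Finset E) : Finset (GroundSet E) :=
  Finset.univ.filter fun x => x ≠ choiceOf s (gunder x)

theorem mem_coTransversal {s : Finset E} {x : GroundSet E} :
    x ∈ coTransversal s ↔ x ≠ choiceOf s (gunder x) := by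
  simp [coTransversal]

theorem isTransversal_coTransversal (s : Finset E) : IsTransversal (coTransversal s) := by
  refine IsTransversal.of_gstar_mem_iff fun x => ?_
  rw [mem_coTransversal, mem_coTransversal, gunder_gstar]
  cases x with
  | inl e => by_cases h : e ∈ s <;> simp [gstar, gunder, choiceOf, h]
  | inr e => by_cases h : e ∈ s <;> simp [gstar, gunder, choiceOf, h]

theorem Basis.eq_coTransversal (B : M.Basis) :
    B.1 = coTransversal (Finset.univ.filter fun e => Sum.inl e ∉ B.1) := by
  ext x
  rw [mem_coTransversal]
  have h := B.gstar_mem_iff x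
  cases x <;> simp only [gstar, gunder, choiceOf, Sum.swap_inl, Sum.swap_inr, Sum.elim_inl,
    Sum.elim_inr, id, Finset.mem_filter, Finset.mem_univ, true_and] at h ⊢ <;> split_ifs <;>
    simp_all

theorem coTransversal_injective : Function.Injective (coTransversal : Finset E → _) := by
  intro s t h
  ext e
  have := Finset.ext_iff.1 h (Sum.inl e)
  simp only [mem_coTransversal, gunder, choiceOf, Sum.elim_inl, id] at this
  by_cases h1 : e ∈ s <;> by_cases h2 : e ∈ t <;> simp_all

theorem Basis.outside_eq_choiceOf {s : Finset E} (hs : coTransversal s ∈ M.bases) (e : E) :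
    Basis.outside (⟨coTransversal s, hs⟩ : M.Basis) e = choiceOf s e := by
  unfold outside choiceOf
  simp only [mem_coTransversal, gunder, choiceOf, Sum.elim_inl, id]
  split_ifs <;> simp_all

-- Bases are indexed by subsets of E through their complements, to match the terms of the
-- determinant expansion in `det_gproj_fundVec`.
open Classical in
theorem card_basis_eq :
    Nat.card M.Basis = (Finset.univ.filter fun s : Finset E => coTransversal s ∈ M.bases).card := by
  rw [← Fintype.card_subtype, ← Nat.card_eq_fintype_card]
  refine Nat.card_congr (Equiv.ofBijective (fun s => ⟨coTransversal s.1, s.2⟩) ⟨?_, ?_⟩).symm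
  · intro s t h
    exact Subtype.ext (coTransversal_injective (congrArg Subtype.val h))
  · intro B
    exact ⟨⟨_, B.eq_coTransversal ▸ B.2⟩, Subtype.ext B.eq_coTransversal.symm⟩

end OrthogonalMatroid

namespace RegularRepresentation

open OrthogonalMatroid

variable {E : Type*} [Fintype E] [DecidableEq E] {M : OrthogonalMatroid E}
  (C : RegularRepresentation M)

/-- The coordinates of the fundamental circuits of `B` at the elements of a transversal. -/
noncomputable def fundMatrix (B : M.Basis) (s : Finset E) : Matrix E E ℤ :=
  Matrix.of fun e f => C.fundVec B e (choiceOf s f)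

/-- This is the change of coordinates between the fundamental circuits of two bases, invertible over
ℤ. -/
theorem det_fundMatrix_of_mem_bases (B : M.Basis) {s : Finset E} (hs : coTransversal s ∈ M.bases) :
    IsUnit (C.fundMatrix B s).det := by
  have h : (Matrix.of fun e f =>
      C.fundVec ⟨coTransversal s, hs⟩ e (B.outside f)) * C.fundMatrix B s = 1 := by
    ext e f
    have := C.eq_sum_fundVec B (C.circuit_mem_perp_int (C.fundVec_mem ⟨coTransversal s, hs⟩ e))
      (choiceOf s f)
    rw [← Basis.outside_eq_choiceOf hs, fundVec_outside] at this
    rw [Matrix.mul_apply, Matrix.one_apply, this, Basis.outside_eq_choiceOf]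
    simp [fundMatrix]
  have hd := congrArg Matrix.det h
  rw [Matrix.det_mul, Matrix.det_one] at hd
  exact IsUnit.of_mul_eq_one_right _ hd

/-- A transversal that is not a basis contains a circuit, which vanishes on the complement; its
coordinates with respect to B are a nonzero left kernel vector. -/
theorem det_fundMatrix_of_notMem_bases (B : M.Basis) {s : Finset E}
    (hs : coTransversal s ∉ M.bases) : (C.fundMatrix B s).det = 0 := by
  have hT := isTransversal_coTransversal s
  obtain ⟨K, hK, hKc⟩ := exists_isCircuit_subset (M := M) ⟨_, hT, subset_rfl⟩
    fun B' hB' h => hs (hT.eq_of_subset (M.isTransversal _ hB') h ▸ hB')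
  obtain ⟨D, hD, rfl⟩ := C.exists_vsupp_eq hKc
  refine Matrix.exists_vecMul_eq_zero_iff.1 ⟨fun e => D (B.outside e), fun h => ?_, ?_⟩
  · obtain ⟨x, hx, hxB⟩ := C.exists_notMem_basis hD B
    rw [← B.outside_gunder hxB] at hx
    exact hx (congrFun h _)
  · funext f
    have h0 : D (choiceOf s f) = 0 := by
      by_contra hne
      refine mem_coTransversal.1 (hK (mem_vsupp.2 hne)) ?_
      rw [gunder_choiceOf]
    have := C.eq_sum_fundVec B (C.circuit_mem_perp_int hD) (choiceOf s f)
    rw [h0] at this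
    simpa [Matrix.vecMul, dotProduct, fundMatrix] using this.symm

/-- The determinant of a real matrix is nonnegative if the half-open segment from the identity
matrix to it contains no singular matrix. -/
theorem _root_.Matrix.det_nonneg_of_segment {A : Matrix E E ℝ}
    (h : ∀ t : ℝ, 0 ≤ t → t < 1 → ((1 - t) • (1 : Matrix E E ℝ) + t • A).det ≠ 0) :
    0 ≤ A.det := by
  have hcont : Continuous fun t : ℝ => ((1 - t) • (1 : Matrix E E ℝ) + t • A).det := by
    refine Continuous.matrix_det ?_
    fun_prop
  by_contra hneg
  rw [not_le] at hneg
  obtain ⟨t, ht, h0⟩ := intermediate_value_Icc' zero_le_one hcont.continuousOn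
    (show (0 : ℝ) ∈ Set.Icc _ _ by simpa using hneg.le)
  refine h t ht.1 (lt_of_le_of_ne ht.2 ?_) h0
  rintro rfl
  simp at h0
  exact hneg.ne h0

/-- A left kernel vector a at a point t < 1 of the segment from the identity gives v in `perp` with
entries `a f` off B and `(1 - t) * a f + t * v (choiceOf s f) = 0`. Multiplying by `a f` and summing
over f eliminates the products `v e * v e*` and leaves `(1 - t) * ∑ a f ^ 2 = 0`, so a is zero. -/
theorem det_fundMatrix_nonneg (B : M.Basis) (s : Finset E) : 0 ≤ (C.fundMatrix B s).det := by
  have key : (0 : ℝ) ≤ ((C.fundMatrix B s).map (Int.castRingHom ℝ)).det := by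
    refine Matrix.det_nonneg_of_segment fun t ht0 ht1 hdet => ?_
    obtain ⟨a, ha, hav⟩ := Matrix.exists_vecMul_eq_zero_iff.2 hdet
    set v : GroundSet E → ℝ := ∑ e, a e • fun x => (C.fundVec B e x : ℝ) with hv
    have hvx : ∀ x, v x = ∑ e, a e * C.fundVec B e x := fun x => by simp [hv]
    have hvp : v ∈ C.perp ℝ := Submodule.sum_mem _ fun e _ =>
      Submodule.smul_mem _ _ (C.circuit_mem_perp (C.fundVec_mem B e))
    have hvo : ∀ e, v (B.outside e) = a e := fun e => by simp [hvx, fundVec_outside]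
    have heq : ∀ f, (1 - t) * v (B.outside f) + t * v (choiceOf s f) = 0 := fun f => by
      have := congrFun hav f
      simp only [Matrix.vecMul, dotProduct, Matrix.add_apply, Matrix.smul_apply, Matrix.one_apply,
        fundMatrix, Matrix.map_apply, Matrix.of_apply, smul_eq_mul, mul_add, Finset.sum_add_distrib,
        Pi.zero_apply] at this
      rw [hvo, hvx, Finset.mul_sum, ← this]
      congr 1
      · simp [mul_comm]
      · exact Finset.sum_congr rfl fun e _ => by simp; ring
    have hsq : ∀ f, (1 - t) * a f ^ 2 + t * (v (Sum.inl f) * v (Sum.inr f)) = 0 := fun f => by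
      have h1 := heq f
      have h2 := hvo f
      have h3 : a f * ((1 - t) * a f + t * v (choiceOf s f)) = 0 := by rw [← h2, h1, mul_zero]
      rw [h2] at h1
      unfold choiceOf at h1 h3
      unfold Basis.outside at h2
      -- Where the chosen element is itself outside B, `h1` already says that v vanishes there, and
      -- so does the product.
      split_ifs at h1 h2 h3 <;> rw [← h2] at h1 h3 ⊢
      · linear_combination h3
      · have h4 : v (Sum.inl f) = 0 := by linarith
        rw [h4]
        ring
      · have h4 : v (Sum.inr f) = 0 := by linarith
        rw [h4]
        ring
      · linear_combination h3
    have hsum := Finset.sum_congr rfl fun f (_ : f ∈ Finset.univ) => hsq f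
    rw [Finset.sum_add_distrib, ← Finset.mul_sum, ← Finset.mul_sum,
      C.sum_inl_mul_inr_eq_zero hvp, mul_zero, add_zero, Finset.sum_const_zero] at hsum
    have h0 : ∑ f, a f ^ 2 = 0 := (mul_eq_zero.1 hsum).resolve_left (by linarith)
    exact ha (funext fun f => by
      simpa using (Finset.sum_eq_zero_iff_of_nonneg fun f _ => sq_nonneg (a f)).1 h0 f
        (Finset.mem_univ f))
  rw [← RingHom.mapMatrix_apply, ← RingHom.map_det] at key
  simpa using key

/-- Each column is the sum of its parts at e and at e*. Multilinear expansion gives one minor per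
transversal, which is a unit or zero and nonnegative, hence 1 or 0. -/
theorem det_gproj_fundVec (B : M.Basis) :
    (Matrix.of fun e => gproj (C.fundVec B e)).det = Nat.card M.Basis := by
  classical
  have h := (Matrix.detRowAlternating (R := ℤ) (n := E)).map_add_univ
    (fun f e => C.fundVec B e (Sum.inl f)) (fun f e => C.fundVec B e (Sum.inr f))
  rw [← Matrix.det_transpose]
  refine Eq.trans h ?_
  have hterm : ∀ s : Finset E, Matrix.detRowAlternating
      (s.piecewise (fun f e => C.fundVec B e (Sum.inl f)) fun f e => C.fundVec B e (Sum.inr f)) =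
      if coTransversal s ∈ M.bases then 1 else 0 := fun s => by
    have : Matrix.detRowAlternating (s.piecewise (fun f e => C.fundVec B e (Sum.inl f))
        fun f e => C.fundVec B e (Sum.inr f)) = (C.fundMatrix B s).det := by
      rw [← Matrix.det_transpose]
      change Matrix.det _ = Matrix.det _
      congr 1
      ext f e
      simp only [Finset.piecewise, Matrix.transpose_apply, fundMatrix, Matrix.of_apply, choiceOf]
      split_ifs <;> rfl
    rw [this]
    split_ifs with hs
    · have := C.det_fundMatrix_nonneg B s
      rcases Int.isUnit_iff.1 (C.det_fundMatrix_of_mem_bases B hs) with h | h <;> omega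
    · exact C.det_fundMatrix_of_notMem_bases B hs
  rw [Finset.sum_congr rfl fun s _ => hterm s, card_basis_eq, Finset.sum_boole]

theorem card_basis_pos : 0 < Nat.card M.Basis :=
  have : Nonempty M.Basis := M.bases_nonempty.to_subtype
  Nat.card_pos

/-- The order of the Jacobian group is the number of bases. -/
theorem card_jac : Nat.card C.Jac = Nat.card M.Basis := by
  obtain ⟨B⟩ : Nonempty M.Basis := M.bases_nonempty.to_subtype
  have hdet := C.det_gproj_fundVec B
  have hli : LinearIndependent ℤ fun e => gproj (C.fundVec B e) :=
    Matrix.linearIndependent_rows_of_det_ne_zero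
      (A := Matrix.of fun e => gproj (C.fundVec B e)) (by
        rw [hdet]
        exact_mod_cast (card_basis_pos (M := M)).ne')
  have hspan : C.lattice =
      (Submodule.span ℤ (Set.range fun e => gproj (C.fundVec B e))).toAddSubgroup := by
    refine le_antisymm ?_ ?_
    · intro u hu
      obtain ⟨v, hv, rfl⟩ := C.mem_lattice.1 hu
      have : v = ∑ e, v (B.outside e) • C.fundVec B e := by
        funext x
        simpa using C.eq_sum_fundVec B hv x
      rw [this]
      change gprojHom E _ ∈ Submodule.span ℤ _
      rw [map_sum]
      refine Submodule.sum_mem _ fun e _ => ?_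
      rw [map_smul]
      exact Submodule.smul_mem _ _ (Submodule.subset_span ⟨e, rfl⟩)
    · intro u hu
      have : Submodule.span ℤ (Set.range fun e => gproj (C.fundVec B e)) ≤
          AddSubgroup.toIntSubmodule C.lattice := by
        rw [Submodule.span_le]
        rintro _ ⟨e, rfl⟩
        exact C.gproj_mem_lattice (C.fundVec_mem B e)
      exact this hu
  -- The index of a full-rank sublattice is the absolute determinant of a basis of it.
  have h := Submodule.natAbs_det_basis_change (Pi.basisFun ℤ E) _ (Module.Basis.span hli)
  have h2 : Nat.card C.Jac = Nat.card ((E → ℤ) ⧸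
      Submodule.span ℤ (Set.range fun e => gproj (C.fundVec B e))) := by
    unfold Jac
    rw [hspan]
    rfl
  rw [h2, ← h]
  have h3 : (Pi.basisFun ℤ E).det ((↑) ∘ Module.Basis.span hli) =
      (Matrix.of fun e => gproj (C.fundVec B e)).det := by
    rw [Pi.basisFun_det_apply]
    congr 1
    ext e f
    simp [Module.Basis.span_apply]
  rw [h3, hdet, Int.natAbs_natCast]

instance finite_jac : Finite C.Jac :=
  Nat.finite_of_card_ne_zero (by
    rw [C.card_jac]
    exact card_basis_pos.ne')

end RegularRepresentation

/-! ### Skew-symmetric matrix games -/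

/-- A symmetric matrix game has value zero. -/
theorem exists_nonneg_mul_nonpos_of_skew {ι : Type*} [Fintype ι] [Nonempty ι] {A : ι → ι → ℝ}
    (hA : ∀ i j, A i j = -A j i) :
    ∃ y : ι → ℝ, (∀ i, 0 ≤ y i) ∧ y ≠ 0 ∧ ∀ i, ∑ j, A i j * y j ≤ 0 := by
  classical
  let L : (ι → ℝ) →ₗ[ℝ] (ι → ℝ) := (Matrix.of A).mulVecLin
  have hL : ∀ y i, L y i = ∑ j, A i j * y j := fun y i => rfl
  by_cases hdisj : Disjoint (L '' stdSimplex ℝ ι) {z | ∀ i, z i ≤ 0}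
  · exfalso
    -- If no strategy works, a functional f separates the image of the simplex from the nonpositive
    -- orthant. As 0 lies in the orthant, f is negative on the image.
    obtain ⟨f, u, v, hu, huv, hv⟩ := geometric_hahn_banach_compact_closed
      ((convex_stdSimplex ℝ ι).linear_image L)
      ((isCompact_stdSimplex ℝ ι).image L.continuous_of_finiteDimensional)
      (t := {z | ∀ i, z i ≤ 0})
      (fun a ha b hb r s hr hs _ i => by
        simp only [Pi.add_apply, Pi.smul_apply, smul_eq_mul]
        exact add_nonpos (mul_nonpos_of_nonneg_of_nonpos hr (ha i))
          (mul_nonpos_of_nonneg_of_nonpos hs (hb i)))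
      (by
        simp only [Set.ofPred_forall]
        exact isClosed_iInter fun i => isClosed_le (continuous_apply i) continuous_const)
      hdisj
    set p : ι → ℝ := fun i => f (Pi.single i 1) with hp
    have hf : ∀ z, f z = ∑ i, p i * z i := fun z => by
      conv_lhs => rw [← Finset.univ_sum_single z]
      rw [map_sum]
      refine Finset.sum_congr rfl fun i _ => ?_
      rw [hp, mul_comm, ← smul_eq_mul, ← map_smul, ← Pi.single_smul, smul_eq_mul, mul_one]
    have hv0 : v < 0 := by simpa using hv 0 fun i => le_rfl
    have hp0 : ∀ i, p i ≤ 0 := fun i => by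
      by_contra hpos
      rw [not_le] at hpos
      -- If `p i` were positive, this vector would lie in the orthant and have f-value exactly v,
      -- against the strict bound.
      have := hv ((v / p i) • Pi.single i 1) fun j => by
        rw [Pi.smul_apply, smul_eq_mul]
        refine mul_nonpos_of_nonpos_of_nonneg (div_nonpos_of_nonpos_of_nonneg hv0.le hpos.le) ?_
        by_cases hij : j = i
        · subst hij; simp
        · simp [hij]
      rw [map_smul, smul_eq_mul] at this
      change v < v / p i * p i at this
      rw [div_mul_cancel₀ _ hpos.ne'] at this
      exact this.false
    have hskew : ∑ i, p i * ∑ j, A i j * p j = 0 := by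
      have h1 : ∑ i, p i * ∑ j, A i j * p j = ∑ i, ∑ j, p i * A i j * p j := by
        simp only [Finset.mul_sum, mul_assoc]
      have h2 : ∑ i, ∑ j, p i * A i j * p j = -∑ i, ∑ j, p i * A i j * p j := by
        conv_lhs => rw [Finset.sum_comm]
        simp only [← Finset.sum_neg_distrib]
        refine Finset.sum_congr rfl fun i _ => Finset.sum_congr rfl fun j _ => ?_
        rw [hA j i]
        ring
      linarith
    have hsum : ∑ i, p i < 0 := by
      refine lt_of_le_of_ne (Finset.sum_nonpos fun i _ => hp0 i) fun h0 => ?_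
      have hpz : ∀ i, p i = 0 := fun i =>
        (Finset.sum_eq_zero_iff_of_nonpos fun i _ => hp0 i).1 h0 i (Finset.mem_univ i)
      obtain ⟨i⟩ := (inferInstance : Nonempty ι)
      have := hu _ ⟨_, single_mem_stdSimplex ℝ i, rfl⟩
      rw [hf] at this
      simp only [hpz, zero_mul, Finset.sum_const_zero] at this
      linarith
    -- Normalized, p itself is a strategy. On its image f is zero by skew-symmetry, although f is
    -- negative there.
    have := hu _ ⟨(∑ i, p i)⁻¹ • p, ⟨fun i => by
      rw [Pi.smul_apply, smul_eq_mul]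
      exact mul_nonneg_of_nonpos_of_nonpos (inv_nonpos.2 hsum.le) (hp0 i), by
      simp only [Pi.smul_apply, smul_eq_mul]
      rw [← Finset.mul_sum, inv_mul_cancel₀ hsum.ne]⟩, rfl⟩
    rw [map_smul, map_smul, hf] at this
    simp only [hL, hskew, smul_zero] at this
    linarith
  · obtain ⟨_, ⟨y, hy, rfl⟩, hz⟩ := Set.not_disjoint_iff.1 hdisj
    refine ⟨y, hy.1, ?_, hz⟩
    rintro rfl
    simpa using hy.2

/-- The game is played on S only, and the strategy is extended by zero. -/
theorem exists_nonneg_mul_nonpos_of_skew_on {E : Type*} [Fintype E] {S : Finset E}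
    (hS : S.Nonempty) {A : E → E → ℝ} (hA : ∀ i j, A i j = -A j i) :
    ∃ y : E → ℝ, (∀ i, 0 ≤ y i) ∧ y ≠ 0 ∧ (∀ i, i ∉ S → y i = 0) ∧
      ∀ i ∈ S, ∑ j, A i j * y j ≤ 0 := by
  classical
  have := hS.to_subtype
  obtain ⟨y, hy, hy0, hAy⟩ := exists_nonneg_mul_nonpos_of_skew
    (A := fun i j : S => A i j) fun i j => hA i j
  refine ⟨fun i => if h : i ∈ S then y ⟨i, h⟩ else 0, fun i => ?_, fun h => hy0 ?_, fun i hi => ?_,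
    fun i hi => ?_⟩
  · dsimp only
    split_ifs
    exacts [hy _, le_rfl]
  · funext i
    simpa using congrFun h i
  · simp [hi]
  · refine le_of_eq_of_le ?_ (hAy ⟨i, hi⟩)
    rw [← Finset.sum_subset (Finset.subset_univ S) (fun j _ hj => by simp [hj]),
      ← Finset.sum_coe_sort]
    simp

namespace EOrientation

variable {E : Type*}

/-- The sign vector of an orientation. -/
def sgn (O : EOrientation E) (e : E) : ℤ := 2 * O.ind e - 1

theorem sgn_eq_or (O : EOrientation E) (e : E) : O.sgn e = 1 ∨ O.sgn e = -1 := by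
  unfold sgn
  rcases O.ind_eq_or e with h | h <;> rw [h] <;> simp

end EOrientation

theorem Fourientation.mem_ofBasis {E : Type*} {B : Finset (GroundSet E)} {O : EOrientation E}
    {x : GroundSet E} {s : ℤˣ} :
    s ∈ ofBasis B O x ↔ x ∈ B ∨ (s : ℤ) = O.sgn (gunder x) := by
  unfold ofBasis EOrientation.sgn EOrientation.ind
  by_cases hx : x ∈ B
  · simp [hx]
  · by_cases hO : 0 < O.1 (gunder x) <;> rcases Int.units_eq_one_or s with rfl | rfl <;>
      simp [hx, hO]

/-! ### Injectivity of triangulating maps on reversal classes -/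

namespace RegularRepresentation

open OrthogonalMatroid

variable {E : Type*} [Fintype E] [DecidableEq E] {M : OrthogonalMatroid E}
  (C : RegularRepresentation M)

theorem contains_iff {B₁ B₂ : Finset (GroundSet E)} {O₁ O₂ : EOrientation E}
    {D : GroundSet E → ℤ} (hD : D ∈ C.circuits) :
    ((Fourientation.ofBasis B₁ O₁).inter (Fourientation.ofBasis B₂ O₂).opposite).Contains D ↔
      ∀ x, D x ≠ 0 → (x ∈ B₁ ∨ D x = O₁.sgn (gunder x)) ∧ (x ∈ B₂ ∨ -D x = O₂.sgn (gunder x)) := by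
  refine forall_congr' fun x => ?_
  simp only [Fourientation.inter, Fourientation.opposite, Set.mem_inter_iff, Set.mem_ofPred_eq,
    Fourientation.mem_ofBasis, Units.val_neg]
  constructor
  · intro h hx
    rcases C.entries D hD x with h' | h' | h'
    · exact absurd h' hx
    · simpa [h'] using h 1 (by simpa using h')
    · simpa [h'] using h (-1) (by simpa using h')
  · intro h s hs
    rw [← hs]
    exact h (by rw [hs]; exact s.ne_zero)

/-- In the orthogonality relation of the fundamental circuits of e and f, only the two summands at
`B.outside e` and `gstar (B.outside f)` can be nonzero. The diagonal case holds because supports are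
subtransversals. -/
theorem fundVec_gstar_outside (B : M.Basis) (e f : E) :
    C.fundVec B e (gstar (B.outside f)) = -C.fundVec B f (gstar (B.outside e)) := by
  have hself : ∀ e, C.fundVec B e (gstar (B.outside e)) = 0 := fun e =>
    C.apply_gstar_eq_zero (C.fundVec_mem B e) (by simp [fundVec_outside])
  by_cases hef : e = f
  · subst hef
    simp [hself]
  have h := C.orthogonal _ (C.fundVec_mem B e) _ (C.fundVec_mem B f)
  have hne : B.outside e ≠ gstar (B.outside f) := fun h' =>
    B.outside_notMem e (h' ▸ (B.gstar_mem_iff _).2 (B.outside_notMem f))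
  rw [Finset.sum_eq_add (B.outside e) (gstar (B.outside f)) hne] at h
  · rw [gstar_gstar, fundVec_outside_self, fundVec_outside_self] at h
    linarith
  · rintro x - ⟨hx1, hx2⟩
    by_cases hx : x ∈ B.1
    · have hx' : gstar x ∉ B.1 := fun h' => (B.gstar_mem_iff x).1 h' hx
      rw [C.fundVec_eq_zero B f hx' fun h' => hx2 (by rw [← h', gstar_gstar]), mul_zero]
    · rw [C.fundVec_eq_zero B e hx hx1, zero_mul]
  · simp
  · simp

/-- For two distinct bases and one orientation there is a signed circuit in the associated
fourientation. -/
theorem exists_circuit_of_ne {B₁ B₂ : M.Basis} (hB : B₁ ≠ B₂) (O : EOrientation E) :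
    ∃ D ∈ C.circuits, ∀ x, D x ≠ 0 →
      (x ∈ B₁.1 ∨ D x = O.sgn (gunder x)) ∧ (x ∈ B₂.1 ∨ -D x = O.sgn (gunder x)) := by
  -- S collects the pairs on which the two bases differ.
  set S : Finset E := Finset.univ.filter fun e => B₁.outside e ∈ B₂.1 with hSdef
  have hmemS : ∀ e, e ∈ S ↔ B₁.outside e ∈ B₂.1 := fun e => by simp [hSdef]
  have hS : S.Nonempty := by
    by_contra hS
    rw [Finset.not_nonempty_iff_eq_empty] at hS
    refine hB (Subtype.ext ((M.isTransversal _ B₂.2).eq_of_subset (M.isTransversal _ B₁.2)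
      fun x hx => ?_).symm)
    by_contra hx1
    have := (hmemS (gunder x)).2 (by rwa [B₁.outside_gunder hx1])
    simp [hS] at this
  have hsq : ∀ e, (O.sgn e : ℝ) * O.sgn e = 1 := fun e => by
    rcases O.sgn_eq_or e with h | h <;> simp [h]
  -- Off B₁, the combination v built from the strategy y has the signs of O. At the partners of
  -- elements outside B₁, for pairs in S, the inequality for y says that v has the opposite sign or
  -- vanishes. So no product `v e * v e*` is positive.
  obtain ⟨y, hy, hy0, hyS, hAy⟩ := exists_nonneg_mul_nonpos_of_skew_on hS
    (A := fun f g => (O.sgn f : ℝ) * O.sgn g * C.fundVec B₁ g (gstar (B₁.outside f)))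
    fun f g => by
      rw [C.fundVec_gstar_outside B₁ g f]
      push_cast
      ring
  set v : GroundSet E → ℝ := ∑ g, (y g * O.sgn g) • fun x => (C.fundVec B₁ g x : ℝ) with hv
  have hvx : ∀ x, v x = ∑ g, y g * O.sgn g * C.fundVec B₁ g x := fun x => by simp [hv]
  have hvp : v ∈ C.perp ℝ := Submodule.sum_mem _ fun e _ =>
    Submodule.smul_mem _ _ (C.circuit_mem_perp (C.fundVec_mem B₁ e))
  have hvo : ∀ f, v (B₁.outside f) = y f * O.sgn f := fun f => by simp [hvx, fundVec_outside]
  have hvs : ∀ f ∈ S, O.sgn f * v (gstar (B₁.outside f)) ≤ 0 := fun f hf => by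
    refine le_of_eq_of_le ?_ (hAy f hf)
    rw [hvx, Finset.mul_sum]
    exact Finset.sum_congr rfl fun g _ => by ring
  have hprod : ∀ f, v (B₁.outside f) * v (gstar (B₁.outside f)) ≤ 0 := fun f => by
    by_cases hf : f ∈ S
    · rw [hvo, mul_assoc]
      exact mul_nonpos_of_nonneg_of_nonpos (hy f) (hvs f hf)
    · rw [hvo, hyS f hf, zero_mul, zero_mul]
  have hprod' : ∀ f, v (B₁.outside f) * v (gstar (B₁.outside f)) =
      v (Sum.inl f) * v (Sum.inr f) := fun f => by
    unfold Basis.outside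
    split_ifs
    · exact mul_comm _ _
    · rfl
  have hzero : ∀ f, v (Sum.inl f) * v (Sum.inr f) = 0 := fun f =>
    (Finset.sum_eq_zero_iff_of_nonpos fun f _ => hprod' f ▸ hprod f).1
      (C.sum_inl_mul_inr_eq_zero hvp) f (Finset.mem_univ f)
  obtain ⟨D, hD, hDv⟩ := C.exists_conformal_circuit hvp
    (fun h => hy0 (funext fun f => by
      have h1 := hvo f
      rw [h] at h1
      have h2 : y f * (O.sgn f * O.sgn f) = 0 := by
        rw [← mul_assoc, ← h1, Pi.zero_apply, zero_mul]
      rwa [hsq, mul_one] at h2))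
    (by
      rintro (e | e) hx
      · exact (mul_eq_zero.1 (hzero e)).resolve_left hx
      · exact (mul_eq_zero.1 (hzero e)).resolve_right hx)
  refine ⟨D, hD, fun x hx => ⟨?_, ?_⟩⟩
  · by_cases hx1 : x ∈ B₁.1
    · exact Or.inl hx1
    · right
      have h1 := hDv x hx
      have h2 := hvo (gunder x)
      rw [B₁.outside_gunder hx1] at h2
      have h3 := hy (gunder x)
      rw [h2] at h1
      rcases C.entries D hD x with h | h | h
      · exact absurd h hx
      all_goals
        rcases O.sgn_eq_or (gunder x) with h' | h' <;> first
          | (simp [h, h']; done)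
          | (rw [h, h'] at h1; push_cast at h1; linarith)
  · by_cases hx2 : x ∈ B₂.1
    · exact Or.inl hx2
    · right
      have h1 := hDv x hx
      by_cases hx1 : x ∈ B₁.1
      · have hx' : gstar x ∉ B₁.1 := fun h' => (B₁.gstar_mem_iff x).1 h' hx1
        have ho : B₁.outside (gunder x) = gstar x := by
          rw [← gunder_gstar, B₁.outside_gunder hx']
        have h2 := hvs (gunder x) ((hmemS _).2 (by rw [ho]; exact (B₂.gstar_mem_iff x).2 hx2))
        rw [ho, gstar_gstar] at h2
        rcases C.entries D hD x with h | h | h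
        · exact absurd h hx
        all_goals
          rcases O.sgn_eq_or (gunder x) with h' | h' <;> first
            | (simp [h, h']; done)
            | (rw [h] at h1; rw [h'] at h2; push_cast at h1 h2; linarith)
      -- Outside both bases the pair is not in S, so v vanishes at x and D cannot be conformal to
      -- it.
      · have h2 := hvo (gunder x)
        rw [B₁.outside_gunder hx1, hyS (gunder x)
          (by rw [hmemS, B₁.outside_gunder hx1]; exact hx2)] at h2
        rw [h2] at h1
        simp at h1

theorem betaBar_injective {β : M.Basis → EOrientation E} (hβ : C.IsTriangulating β) :
    Function.Injective (C.betaBar β) := by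
  intro B₁ B₂ h
  obtain ⟨v, hv, hvu⟩ := C.mem_lattice.1 (C.revClass_eq_iff.1 h)
  by_cases h0 : v = 0
  · have hO : β B₁ = β B₂ := EOrientation.ind_injective <| by
      rw [← sub_eq_zero, ← neg_sub, ← hvu, h0]
      funext e
      simp [gproj]
    by_contra hB
    obtain ⟨D, hD, hDx⟩ := C.exists_circuit_of_ne hB (β B₁)
    refine hβ B₁ B₂ D hD ((C.contains_iff hD).2 ?_)
    rwa [← hO]
  · obtain ⟨D, hD, hDx⟩ := C.exists_conformal_circuit_of_gproj hv h0 hvu.symm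
    -- On its support D has the signs of `β B₂` and the opposite of those of `β B₁`, so the
    -- forbidden circuit is `-D`.
    refine absurd ((C.contains_iff (C.neg_mem D hD)).2 fun x hx => ?_)
      (hβ B₁ B₂ (-D) (C.neg_mem D hD))
    have hx' : D x ≠ 0 := by simpa using hx
    obtain ⟨h1, h2⟩ := hDx x hx'
    have h3 := (β B₁).ind_eq_or (gunder x)
    have h4 := (β B₂).ind_eq_or (gunder x)
    simp only [EOrientation.sgn, Pi.neg_apply]
    exact ⟨Or.inr (by omega), Or.inr (by omega)⟩

/-! ### Acyclic signatures -/

theorem eq_fundVec (B : M.Basis) (e : E) {D : GroundSet E → ℤ} (hD : D ∈ C.circuits)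
    (hsupp : vsupp D ⊆ B.1 ∆ {B.outside e, gstar (B.outside e)}) (h1 : D (B.outside e) = 1) :
    D = C.fundVec B e := by
  rw [← sub_eq_zero]
  refine C.eq_zero_of_mem_perp B (Submodule.sub_mem _ (C.circuit_mem_perp_int hD)
    (C.circuit_mem_perp_int (C.fundVec_mem B e))) fun x hx => ?_
  by_cases hxe : x = B.outside e
  · simp [hxe, h1, fundVec_outside]
  · have : D x = 0 := by
      by_contra hne
      rcases (B.mem_symmDiff_iff (B.outside_notMem e) x).1 (hsupp (mem_vsupp.2 hne)) with h | h
      exacts [hx h.1, hxe h]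
    simp [this, C.fundVec_eq_zero B e hx hxe]

theorem isFundamentalCircuit_fundVec (B : M.Basis) (e : E) :
    M.IsFundamentalCircuit B (B.outside e) (vsupp (C.fundVec B e)) := by
  refine ⟨C.isCircuit_vsupp (C.fundVec_mem B e), fun x hx => ?_⟩
  rw [mem_vsupp] at hx
  rw [B.mem_symmDiff_iff (B.outside_notMem e)]
  by_cases hxe : x = B.outside e
  · exact Or.inr hxe
  · refine Or.inl ⟨by_contra fun h => hx (C.fundVec_eq_zero B e h hxe), ?_⟩
    rintro rfl
    exact hx (C.apply_gstar_eq_zero (C.fundVec_mem B e) (by simp [fundVec_outside]))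

open Classical in
theorem ind_betaSig {σ : Set (GroundSet E → ℤ)} (hσ : σ ⊆ C.circuits) (B : M.Basis) (e : E) :
    (M.betaSig σ B).ind e = if C.fundVec B e ∈ σ then 1 else 0 := by
  have : (∃ D ∈ σ, M.IsFundamentalCircuit B (B.outside e) (vsupp D) ∧ D (B.outside e) = 1) ↔
      C.fundVec B e ∈ σ := by
    constructor
    · rintro ⟨D, hD, hK, h1⟩
      rwa [← C.eq_fundVec B e (hσ hD) hK.2 h1]
    · intro h
      exact ⟨_, h, C.isFundamentalCircuit_fundVec B e, C.fundVec_outside_self B e⟩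
  unfold EOrientation.ind OrthogonalMatroid.betaSig
  simp only [this]
  split_ifs <;> norm_num at *

theorem sgn_smul_fundVec_mem {σ : Set (GroundSet E → ℤ)} (hσ : C.IsSignature σ) (B : M.Basis)
    (e : E) : (M.betaSig σ B).sgn e • C.fundVec B e ∈ σ := by
  rw [EOrientation.sgn, C.ind_betaSig hσ.1]
  rcases hσ.2 _ (C.fundVec_mem B e) with h | h
  · simp [h.1]
  · simpa [h.2] using h.1

/-- Acyclicity for indexed families with repetitions, obtained by adding up the coefficients over
each fibre. Repetitions do occur when the fundamental circuits of two bases are combined. -/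
theorem IsAcyclicSignature.eq_zero_of_sum {C : RegularRepresentation M}
    {σ : Set (GroundSet E → ℤ)} (hσ : C.IsAcyclicSignature σ) {ι : Type*} [Fintype ι]
    {g : ι → GroundSet E → ℤ} (hg : ∀ i, g i ∈ σ) {c : ι → ℝ} (hc : ∀ i, 0 ≤ c i)
    (h : ∀ x, ∑ i, c i * (g i x : ℝ) = 0) (i : ι) : c i = 0 := by
  classical
  have key := hσ.2 (Finset.univ.image g) (fun D => ∑ i with g i = D, c i)
    (by
      intro D hD
      obtain ⟨i, -, rfl⟩ := Finset.mem_image.1 hD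
      exact hg i)
    (fun D _ => Finset.sum_nonneg fun i _ => hc i)
    (fun x => by
      rw [← h x, ← Finset.sum_fiberwise_of_maps_to
        (fun i _ => Finset.mem_image_of_mem g (Finset.mem_univ i))]
      refine Finset.sum_congr rfl fun D _ => ?_
      rw [Finset.sum_mul]
      refine Finset.sum_congr rfl fun i hi => ?_
      rw [(Finset.mem_filter.1 hi).2])
    (g i) (Finset.mem_image_of_mem g (Finset.mem_univ i))
  exact (Finset.sum_eq_zero_iff_of_nonneg fun i _ => hc i).1 key i (by simp)

/-- A forbidden circuit D would be a nonnegative combination of members of σ by its expansion at B₁,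
and so would `-D` by its expansion at B₂. Their sum is a nontrivial relation, since D is not
supported in B₁. -/
theorem isTriangulating_betaSig {σ : Set (GroundSet E → ℤ)} (hσ : C.IsAcyclicSignature σ) :
    C.IsTriangulating (M.betaSig σ) := by
  intro B₁ B₂ D hD hcont
  rw [C.contains_iff hD] at hcont
  have hexp : ∀ (B : M.Basis) (r : ℤ), (∀ e, D (B.outside e) ≠ 0 →
      r * D (B.outside e) = (M.betaSig σ B).sgn e) → ∀ x, ∑ e, |(D (B.outside e) : ℝ)| *
        (((M.betaSig σ B).sgn e • C.fundVec B e) x : ℤ) = r * D x := fun B r hr x => by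
    have := C.eq_sum_fundVec B (C.circuit_mem_perp_int hD) x
    rw [this]
    push_cast
    rw [Finset.mul_sum]
    refine Finset.sum_congr rfl fun e _ => ?_
    by_cases h0 : D (B.outside e) = 0
    · simp [h0]
    · have h1 := hr e h0
      have h2 : |(D (B.outside e) : ℝ)| = 1 := by
        rcases C.entries D hD (B.outside e) with h | h | h
        · exact absurd h h0
        · simp [h]
        · simp [h]
      rw [h2, ← h1]
      simp only [Pi.smul_apply, smul_eq_mul]
      push_cast
      ring
  have h1 := hexp B₁ 1 fun e he => by
    have := (hcont _ he).1.resolve_left (B₁.outside_notMem e)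
    rw [B₁.gunder_outside] at this
    rw [one_mul, this]
  have h2 := hexp B₂ (-1) fun e he => by
    have := (hcont _ he).2.resolve_left (B₂.outside_notMem e)
    rw [B₂.gunder_outside] at this
    rw [neg_one_mul, this]
  obtain ⟨x, hx, hxB⟩ := C.exists_notMem_basis hD B₁
  have key := hσ.eq_zero_of_sum (ι := E ⊕ E)
    (g := Sum.elim (fun e => (M.betaSig σ B₁).sgn e • C.fundVec B₁ e)
      fun e => (M.betaSig σ B₂).sgn e • C.fundVec B₂ e)
    (by
      rintro (e | e)
      exacts [C.sgn_smul_fundVec_mem hσ.1 B₁ e, C.sgn_smul_fundVec_mem hσ.1 B₂ e])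
    (c := Sum.elim (fun e => |(D (B₁.outside e) : ℝ)|) fun e => |(D (B₂.outside e) : ℝ)|)
    (by rintro (e | e) <;> exact abs_nonneg _)
    (fun x => by
      rw [Fintype.sum_sum_type]
      simp only [Sum.elim_inl, Sum.elim_inr]
      rw [h1, h2]
      push_cast
      ring)
    (Sum.inl (gunder x))
  rw [Sum.elim_inl, B₁.outside_gunder hxB, abs_eq_zero] at key
  exact hx (by exact_mod_cast key)

theorem _root_.eq_zero_of_sum_mul_three_pow {n : ℕ} {d : Fin n → ℤ}
    (hd : ∀ i, d i = 0 ∨ d i = 1 ∨ d i = -1) (h : ∑ i, d i * 3 ^ (i : ℕ) = 0) (i : Fin n) :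
    d i = 0 := by
  induction n with
  | zero => exact i.elim0
  | succ n ih =>
    rw [Fin.sum_univ_succ] at h
    have h' : ∑ i : Fin n, d i.succ * 3 ^ (i.succ : ℕ) = 3 * ∑ i : Fin n, d i.succ * 3 ^ (i : ℕ) := by
      rw [Finset.mul_sum]
      exact Finset.sum_congr rfl fun i _ => by rw [Fin.val_succ, pow_succ]; ring
    rw [h'] at h
    simp only [Fin.val_zero, pow_zero, mul_one] at h
    -- Reduction modulo 3 isolates the last ternary digit.
    have h0 : d 0 = 0 := by
      rcases hd 0 with h0 | h0 | h0 <;> omega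
    refine Fin.cases h0 (fun i => ih (d := fun i => d i.succ) (fun i => hd _) (by omega) i) i

/-- Powers of 3 as weights define a linear functional that vanishes on no signed circuit; the
circuits on its positive side form an acyclic signature. -/
theorem exists_isAcyclicSignature : ∃ σ, C.IsAcyclicSignature σ := by
  set w : GroundSet E → ℤ := fun x => 3 ^ (Fintype.equivFin (GroundSet E) x : ℕ) with hw
  have hne : ∀ D ∈ C.circuits, ∑ x, D x * w x ≠ 0 := fun D hD h => by
    obtain ⟨B⟩ : Nonempty M.Basis := M.bases_nonempty.to_subtype
    obtain ⟨x, hx, -⟩ := C.exists_notMem_basis hD B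
    refine hx ?_
    have := eq_zero_of_sum_mul_three_pow (d := fun i => D ((Fintype.equivFin _).symm i))
      (fun i => C.entries D hD _) (by
        rw [← h]
        refine Fintype.sum_equiv (Fintype.equivFin (GroundSet E)).symm _ _ fun i => ?_
        simp [hw]) (Fintype.equivFin _ x)
    simpa using this
  have hneg : ∀ D : GroundSet E → ℤ, ∑ x, (-D) x * w x = -∑ x, D x * w x := fun D => by
    simp
  refine ⟨{D | D ∈ C.circuits ∧ 0 < ∑ x, D x * w x}, ⟨fun D h => h.1, fun D hD => ?_⟩,
    fun s c hs hc h => ?_⟩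
  · have h1 := hne D hD
    have h2 := hneg D
    rcases h1.lt_or_gt with h | h
    · exact Or.inr ⟨⟨C.neg_mem D hD, by omega⟩, fun h' => by have := h'.2; omega⟩
    · exact Or.inl ⟨⟨hD, h⟩, fun h' => by have := h'.2; omega⟩
  · have hsum : ∑ D ∈ s, c D * ((∑ x, D x * w x : ℤ) : ℝ) = 0 := by
      have : ∑ x, (∑ D ∈ s, c D * (D x : ℝ)) * (w x : ℝ) = 0 := by simp only [h, zero_mul,
        Finset.sum_const_zero]
      rw [← this]
      push_cast
      simp only [Finset.mul_sum, Finset.sum_mul]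
      rw [Finset.sum_comm]
      exact Finset.sum_congr rfl fun x _ => Finset.sum_congr rfl fun D _ => by ring
    have hpos : ∀ D ∈ s, (0 : ℝ) < ((∑ x, D x * w x : ℤ) : ℝ) := fun D hD => by
      exact_mod_cast (hs hD).2
    intro D hD
    have := (Finset.sum_eq_zero_iff_of_nonneg fun D hD =>
      mul_nonneg (hc D hD) (hpos D hD).le).1 hsum D hD
    exact (mul_eq_zero.1 this).resolve_right (hpos D hD).ne'

end RegularRepresentation

/-! ### Transported actions and reorientation of vectors -/

/-- The simply transitive action on `P` that a bijection of `P` with the group induces. -/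
@[reducible]
def addActionOfEquiv {G P : Type*} [AddGroup G] (θ : P ≃ G) : AddAction G P where
  vadd g p := θ.symm (g + θ p)
  zero_vadd p := by
    change θ.symm (0 + θ p) = p
    rw [zero_add, θ.symm_apply_apply]
  add_vadd g h p := by
    change θ.symm (g + h + θ p) = θ.symm (g + θ (θ.symm (h + θ p)))
    rw [θ.apply_symm_apply, add_assoc]

theorem addActionOfEquiv_vadd_eq_iff {G P : Type*} [AddGroup G] (θ : P ≃ G) {g : G} {p q : P} :
    (addActionOfEquiv θ).vadd g p = q ↔ g + θ p = θ q :=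
  θ.symm_apply_eq

theorem isSimplyTransitive_addActionOfEquiv {G P : Type*} [AddGroup G] (θ : P ≃ G) :
    IsSimplyTransitive (addActionOfEquiv θ) := fun p q =>
  ⟨θ q - θ p, (addActionOfEquiv_vadd_eq_iff θ).2 (sub_add_cancel _ _), fun _ hg =>
    eq_sub_of_add_eq ((addActionOfEquiv_vadd_eq_iff θ).1 hg)⟩

/-- Reorientation as an automorphism of `ℤ^E`. -/
def flipEquiv {E : Type*} [DecidableEq E] (X : Finset E) : (E → ℤ) ≃+ (E → ℤ) where
  toFun := flipOn X
  invFun := flipOn X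
  left_inv v := by
    funext e
    unfold flipOn
    split_ifs <;> simp
  right_inv v := by
    funext e
    unfold flipOn
    split_ifs <;> simp
  map_add' v w := by
    funext e
    simp only [flipOn, Pi.add_apply]
    split_ifs <;> ring

theorem gproj_gflip {E : Type*} [DecidableEq E] (X : Finset E) (D : GroundSet E → ℤ) :
    gproj (gflip X D) = flipOn X (gproj D) := by
  funext e
  by_cases h : e ∈ X
  · simp [gproj, gflip, flipOn, gunder, h, add_comm]
  · simp [gproj, gflip, flipOn, gunder, h]

theorem gflip_gflip {E : Type*} [DecidableEq E] (X : Finset E) (D : GroundSet E → ℤ) :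
    gflip X (gflip X D) = D := by
  funext x
  unfold gflip
  split_ifs <;> simp

theorem gflip_injective {E : Type*} [DecidableEq E] (X : Finset E) :
    Function.Injective (gflip X : (GroundSet E → ℤ) → _) :=
  Function.LeftInverse.injective (gflip_gflip X)

theorem gflip_neg {E : Type*} [DecidableEq E] (X : Finset E) (D : GroundSet E → ℤ) :
    gflip X (-D) = -gflip X D := by
  funext x
  simp only [gflip, Pi.neg_apply]
  split_ifs <;> rfl

namespace EOrientation

variable {E : Type*} [DecidableEq E]

theorem ind_flip (X : Finset E) (O : EOrientation E) (e : E) :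
    (O.flip X).ind e = if e ∈ X then 1 - O.ind e else O.ind e := by
  unfold ind flip flipOn
  rcases O.2 e with h | h <;> split_ifs <;> simp_all <;> norm_num at *

theorem sgn_flip (X : Finset E) (O : EOrientation E) (e : E) :
    (O.flip X).sgn e = if e ∈ X then -O.sgn e else O.sgn e := by
  unfold sgn
  rw [ind_flip]
  split_ifs <;> ring

theorem flip_flip (X : Finset E) (O : EOrientation E) : (O.flip X).flip X = O :=
  ind_injective <| funext fun e => by
    rw [ind_flip, ind_flip]
    split_ifs <;> ring

theorem ind_flip_sub (X : Finset E) (O₁ O₂ : EOrientation E) :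
    (O₂.flip X).ind - (O₁.flip X).ind = flipEquiv X (O₂.ind - O₁.ind) := by
  funext e
  change _ = flipOn X (O₂.ind - O₁.ind) e
  rw [Pi.sub_apply, ind_flip, ind_flip]
  simp only [flipOn, Pi.sub_apply]
  split_ifs <;> ring

/-- Reorientation as a permutation of the orientations. -/
def flipPerm (X : Finset E) : EOrientation E ≃ EOrientation E where
  toFun := flip X
  invFun := flip X
  left_inv := flip_flip X
  right_inv := flip_flip X

end EOrientation

/-! ### Bijectivity and the two actions -/

namespace RegularRepresentation

open OrthogonalMatroid

variable {E : Type*} [Fintype E] [DecidableEq E] {M : OrthogonalMatroid E}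
  (C : RegularRepresentation M)

/-- The composite is an injection between finite sets of equal size. -/
theorem bijective_revToJac_comp_betaBar {β : M.Basis → EOrientation E} (hβ : C.IsTriangulating β) :
    Function.Bijective (C.revToJac ∘ C.betaBar β) :=
  (C.revToJac_injective.comp (C.betaBar_injective hβ)).bijective_of_nat_card_le C.card_jac.le

/-- Surjectivity needs some triangulating map; any acyclic signature supplies one. -/
theorem bijective_revToJac : Function.Bijective C.revToJac := by
  obtain ⟨σ, hσ⟩ := C.exists_isAcyclicSignature
  exact ⟨C.revToJac_injective,
    (C.bijective_revToJac_comp_betaBar (C.isTriangulating_betaSig hσ)).2.of_comp⟩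

theorem bijective_betaBar {β : M.Basis → EOrientation E} (hβ : C.IsTriangulating β) :
    Function.Bijective (C.betaBar β) :=
  (Function.Bijective.of_comp_iff' C.bijective_revToJac _).1 (C.bijective_revToJac_comp_betaBar hβ)

/-- The canonical action of the Jacobian group on the circuit reversal system. -/
@[reducible]
noncomputable def revAction : AddAction C.Jac C.ReversalSystem :=
  addActionOfEquiv (Equiv.ofBijective _ C.bijective_revToJac)

/-- The action of the Jacobian group on the bases that a triangulating map induces. -/
@[reducible]
noncomputable def basisAction (β : M.Basis → EOrientation E) (hβ : C.IsTriangulating β) :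
    AddAction C.Jac M.Basis :=
  addActionOfEquiv (Equiv.ofBijective _ (C.bijective_revToJac_comp_betaBar hβ))

theorem revAction_vadd_eq_iff {j : C.Jac} {r s : C.ReversalSystem} :
    C.revAction.vadd j r = s ↔ j + C.revToJac r = C.revToJac s :=
  addActionOfEquiv_vadd_eq_iff _

theorem revAction_vadd_class_iff {v : E → ℤ} {O₁ O₂ : EOrientation E} :
    C.revAction.vadd (C.jacClass v) (C.revClass O₁) = C.revClass O₂ ↔
      O₂.ind - O₁.ind - v ∈ C.lattice := by
  rw [revAction_vadd_eq_iff, revToJac_revClass, revToJac_revClass]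
  have : C.jacClass v + C.jacClass O₁.ind = C.jacClass (v + O₁.ind) := rfl
  rw [this, jacClass_eq_iff, sub_sub, add_comm v]

theorem betaBar_basisAction_vadd {β : M.Basis → EOrientation E} (hβ : C.IsTriangulating β)
    (j : C.Jac) (B : M.Basis) :
    C.betaBar β ((C.basisAction β hβ).vadd j B) = C.revAction.vadd j (C.betaBar β B) := by
  refine (C.revAction_vadd_eq_iff.2 ?_).symm
  exact (addActionOfEquiv_vadd_eq_iff
    (Equiv.ofBijective _ (C.bijective_revToJac_comp_betaBar hβ))).1 rfl

theorem jEquiv_iff {v : E → ℤ} {O₁ O₂ : EOrientation E} :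
    C.JEquiv (toRat v + O₁.1) O₂.1 ↔ O₂.ind - O₁.ind - v ∈ C.lattice := by
  have key : ∀ u, O₂.1 - (toRat v + O₁.1) = toRat u ↔ O₂.ind - O₁.ind - v = u := fun u => by
    rw [sub_eq_iff_eq_add, sub_eq_iff_eq_add (b := v), ← sub_val_eq_iff_ind, toRat_add,
      sub_eq_iff_eq_add, add_assoc]
  constructor
  · rintro ⟨u, hu, h⟩
    rwa [(key u).1 h]
  · exact fun h => ⟨_, h, (key _).2 rfl⟩

/-! ### Reorientation -/

section reorient

variable (X : Finset E)

theorem map_lattice_flipEquiv :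
    C.lattice.map (flipEquiv X).toAddMonoidHom = (C.reorient X).lattice := by
  unfold lattice
  rw [AddMonoidHom.map_closure]
  congr 1
  change flipOn X '' (gproj '' C.circuits) = gproj '' (gflip X '' C.circuits)
  rw [Set.image_image, Set.image_image]
  simp only [gproj_gflip]

theorem flipEquiv_mem_lattice {u : E → ℤ} :
    flipEquiv X u ∈ (C.reorient X).lattice ↔ u ∈ C.lattice := by
  rw [← map_lattice_flipEquiv]
  exact AddSubgroup.mem_map_iff_mem (flipEquiv X).injective

/-- The isomorphism of Jacobian groups induced by reorientation. -/
def jacFlip : C.Jac ≃+ (C.reorient X).Jac :=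
  QuotientAddGroup.congr _ _ (flipEquiv X) (C.map_lattice_flipEquiv X)

theorem jacFlip_jacClass (v : E → ℤ) :
    C.jacFlip X (C.jacClass v) = (C.reorient X).jacClass (flipOn X v) :=
  rfl

/-- The bijection of circuit reversal systems induced by reorientation. -/
def revFlip : C.ReversalSystem ≃ (C.reorient X).ReversalSystem :=
  Quotient.congr (EOrientation.flipPerm X) fun O₁ O₂ => by
    refine C.reflTransGen_reversal_iff.trans
      (Iff.trans ?_ (C.reorient X).reflTransGen_reversal_iff.symm)
    change _ ↔ (O₂.flip X).ind - (O₁.flip X).ind ∈ _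
    rw [EOrientation.ind_flip_sub, flipEquiv_mem_lattice]

theorem revFlip_revClass (O : EOrientation E) :
    C.revFlip X (C.revClass O) = (C.reorient X).revClass (O.flip X) :=
  rfl

theorem revFlip_revAction_vadd (j : C.Jac) (r : C.ReversalSystem) :
    C.revFlip X (C.revAction.vadd j r) =
      (C.reorient X).revAction.vadd (C.jacFlip X j) (C.revFlip X r) := by
  obtain ⟨v, rfl⟩ := C.jacClass_surjective j
  obtain ⟨O₁, rfl⟩ := C.revClass_surjective r
  obtain ⟨O₂, h⟩ := C.revClass_surjective (C.revAction.vadd (C.jacClass v) (C.revClass O₁))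
  rw [← h, jacFlip_jacClass, revFlip_revClass, revFlip_revClass]
  refine ((C.reorient X).revAction_vadd_class_iff.2 ?_).symm
  rw [EOrientation.ind_flip_sub]
  change _ - flipEquiv X v ∈ _
  rw [← map_sub, flipEquiv_mem_lattice]
  exact C.revAction_vadd_class_iff.1 h.symm

theorem isTriangulating_flip {β : M.Basis → EOrientation E} (hβ : C.IsTriangulating β) :
    (C.reorient X).IsTriangulating fun B => (β B).flip X := by
  rintro B₁ B₂ _ ⟨D, hD, rfl⟩ h
  refine hβ B₁ B₂ D hD ((C.contains_iff hD).2 fun x hx => ?_)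
  have h1 := ((C.reorient X).contains_iff ⟨D, hD, rfl⟩).1 h x (by
    unfold gflip
    split_ifs <;> simpa using hx)
  simp only [EOrientation.sgn_flip, gflip] at h1
  split_ifs at h1 <;> simpa only [neg_inj] using h1

theorem isAcyclicSignature_gflip {σ : Set (GroundSet E → ℤ)} (hσ : C.IsAcyclicSignature σ) :
    (C.reorient X).IsAcyclicSignature (gflip X '' σ) := by
  classical
  refine ⟨⟨Set.image_mono hσ.1.1, ?_⟩, fun s c hs hc h D hD => ?_⟩
  · rintro _ ⟨D, hD, rfl⟩
    rw [← gflip_neg, (gflip_injective X).mem_set_image, (gflip_injective X).mem_set_image]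
    exact hσ.1.2 D hD
  · have hinj : Set.InjOn (gflip X) (s : Set (GroundSet E → ℤ)) := (gflip_injective X).injOn
    have key := hσ.2 (s.image (gflip X)) (fun D => c (gflip X D)) (by
      intro D hD
      obtain ⟨D', hD', rfl⟩ := Finset.mem_image.1 hD
      obtain ⟨D, hD, rfl⟩ := hs hD'
      rwa [gflip_gflip]) (by
      intro D hD
      obtain ⟨D', hD', rfl⟩ := Finset.mem_image.1 hD
      rw [gflip_gflip]
      exact hc _ hD') (fun x => by
      rw [Finset.sum_image hinj]
      simp only [gflip_gflip]
      have := h x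
      by_cases hx : gunder x ∈ X
      · simpa [gflip, hx] using this
      · simpa [gflip, hx] using this) _ (Finset.mem_image_of_mem _ hD)
    rwa [gflip_gflip] at key

/-- For e in X, reorientation turns the normalizing entry 1 into -1, so the sign has to be corrected
beforehand. -/
theorem fundVec_reorient (B : M.Basis) (e : E) :
    (C.reorient X).fundVec B e =
      gflip X (if e ∈ X then -C.fundVec B e else C.fundVec B e) := by
  have hsupp := (C.isFundamentalCircuit_fundVec B e).2
  refine ((C.reorient X).eq_fundVec B e ⟨_, ?_, rfl⟩ ?_ ?_).symm
  · split_ifs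
    exacts [C.neg_mem _ (C.fundVec_mem B e), C.fundVec_mem B e]
  · rw [vsupp_gflip]
    split_ifs
    · refine subset_trans (fun x hx => ?_) hsupp
      rw [mem_vsupp] at hx ⊢
      simpa using hx
    · exact hsupp
  · unfold gflip
    rw [B.gunder_outside]
    split_ifs <;> simp [fundVec_outside]

theorem betaSig_gflip {σ : Set (GroundSet E → ℤ)} (hσ : C.IsAcyclicSignature σ) :
    M.betaSig (gflip X '' σ) = fun B => (M.betaSig σ B).flip X := by
  funext B
  refine EOrientation.ind_injective (funext fun e => ?_)
  rw [EOrientation.ind_flip, C.ind_betaSig hσ.1.1,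
    (C.reorient X).ind_betaSig (C.isAcyclicSignature_gflip X hσ).1.1, fundVec_reorient,
    (gflip_injective X).mem_set_image]
  by_cases he : e ∈ X
  · rw [if_pos he, if_pos he]
    -- Exactly one of the fundamental circuit and its negative lies in σ, so testing the negative
    -- complements the indicator.
    rcases hσ.1.2 _ (C.fundVec_mem B e) with h | h <;> simp [h.1, h.2]
  · rw [if_neg he, if_neg he]

/-- Both sides have the same image under the injective map to reversal classes. Keeping `β'` as a
variable with the equation `h` covers both the reoriented map itself and the map of the reoriented
signature. -/
theorem basisAction_reorient_vadd {β β' : M.Basis → EOrientation E} (hβ : C.IsTriangulating β)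
    (h : β' = fun B => (β B).flip X) (hβ' : (C.reorient X).IsTriangulating β')
    (j : C.Jac) (B : M.Basis) :
    ((C.reorient X).basisAction β' hβ').vadd (C.jacFlip X j) B = (C.basisAction β hβ).vadd j B := by
  have hρ : ∀ B, C.revFlip X (C.betaBar β B) = (C.reorient X).betaBar β' B := fun B => by
    rw [h]
    rfl
  refine (C.reorient X).betaBar_injective hβ' ?_
  rw [betaBar_basisAction_vadd, ← hρ, ← revFlip_revAction_vadd, ← C.betaBar_basisAction_vadd hβ, hρ]

end reorient

end RegularRepresentation

theorem theoremB {E : Type*} [Fintype E] [DecidableEq E] (M : OrthogonalMatroid E) :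
    ∃ (α : ∀ C : RegularRepresentation M, AddAction C.Jac C.ReversalSystem)
      (Γ : ∀ (C : RegularRepresentation M) (β : M.Basis → EOrientation E),
        C.IsTriangulating β → AddAction C.Jac M.Basis),
      -- (1) the canonical action on the circuit reversal system
      (∀ C : RegularRepresentation M,
        (∀ (v : E → ℤ) (O₁ O₂ : EOrientation E),
          (α C).vadd (C.jacClass v) (C.revClass O₁) = C.revClass O₂ ↔
            C.JEquiv (toRat v + O₁.1) O₂.1) ∧
        IsSimplyTransitive (α C)) ∧
      -- (2) bijections from bases to circuit reversal classes, and the actions on bases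
      (∀ C : RegularRepresentation M,
        (∀ σ, C.IsAcyclicSignature σ →
          C.IsTriangulating (M.betaSig σ) ∧
          Function.Bijective (C.betaBar (M.betaSig σ))) ∧
        (∀ (β : M.Basis → EOrientation E) (hβ : C.IsTriangulating β),
          Function.Bijective (C.betaBar β) ∧
          (∀ (j : C.Jac) (B : M.Basis),
            C.betaBar β ((Γ C β hβ).vadd j B) = (α C).vadd j (C.betaBar β B)) ∧
          IsSimplyTransitive (Γ C β hβ))) ∧
      -- (3) invariance under reorientation
      (∀ (C : RegularRepresentation M) (X : Finset E),
        ∃ (φ : C.Jac ≃+ (C.reorient X).Jac)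
          (ρ : C.ReversalSystem ≃ (C.reorient X).ReversalSystem),
          (∀ v : E → ℤ, φ (C.jacClass v) = (C.reorient X).jacClass (flipOn X v)) ∧
          (∀ O : EOrientation E, ρ (C.revClass O) = (C.reorient X).revClass (O.flip X)) ∧
          (∀ (j : C.Jac) (r : C.ReversalSystem),
            ρ ((α C).vadd j r) = (α (C.reorient X)).vadd (φ j) (ρ r)) ∧
          (∀ (β : M.Basis → EOrientation E) (hβ : C.IsTriangulating β),
            ∃ hβX : (C.reorient X).IsTriangulating (fun B => (β B).flip X),
              (∀ B : M.Basis,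
                ρ (C.betaBar β B) = (C.reorient X).betaBar (fun B => (β B).flip X) B) ∧
              ∀ (j : C.Jac) (B : M.Basis),
                (Γ (C.reorient X) (fun B => (β B).flip X) hβX).vadd (φ j) B =
                  (Γ C β hβ).vadd j B) ∧
          (∀ σ, C.IsAcyclicSignature σ →
            (C.reorient X).IsAcyclicSignature (gflip X '' σ) ∧
            M.betaSig (gflip X '' σ) = (fun B => (M.betaSig σ B).flip X) ∧
            ∃ (h : C.IsTriangulating (M.betaSig σ))
              (hX : (C.reorient X).IsTriangulating (M.betaSig (gflip X '' σ))),
              ∀ (j : C.Jac) (B : M.Basis),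
                (Γ (C.reorient X) (M.betaSig (gflip X '' σ)) hX).vadd (φ j) B =
                  (Γ C (M.betaSig σ) h).vadd j B)) :=
  ⟨fun C => C.revAction, fun C β hβ => C.basisAction β hβ,
    fun C => ⟨fun _ _ _ => C.revAction_vadd_class_iff.trans C.jEquiv_iff.symm,
      isSimplyTransitive_addActionOfEquiv _⟩,
    fun C => ⟨fun _ hσ => ⟨C.isTriangulating_betaSig hσ,
        C.bijective_betaBar (C.isTriangulating_betaSig hσ)⟩,
      fun _ hβ => ⟨C.bijective_betaBar hβ, C.betaBar_basisAction_vadd hβ,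
        isSimplyTransitive_addActionOfEquiv _⟩⟩,
    fun C X => ⟨C.jacFlip X, C.revFlip X, C.jacFlip_jacClass X, C.revFlip_revClass X,
      C.revFlip_revAction_vadd X,
      fun _ hβ => ⟨C.isTriangulating_flip X hβ, fun _ => rfl,
        C.basisAction_reorient_vadd X hβ rfl _⟩,
      fun _ hσ => ⟨C.isAcyclicSignature_gflip X hσ, C.betaSig_gflip X hσ,
        C.isTriangulating_betaSig hσ,
        (C.reorient X).isTriangulating_betaSig (C.isAcyclicSignature_gflip X hσ),
        C.basisAction_reorient_vadd X _ (C.betaSig_gflip X hσ) _⟩⟩⟩
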